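/- Let $n,m$ be natural numbers, let $E=\mathbb C^n$ and $F=\mathbb C^m$ have the standard bases $(e_i)$, $(f_j)$, and let $u=(u_{(i,j),(k,l)})$ be a unitary $nm\times nm$ matrix with rows and columns indexed by $\{1,\dots,n\}\times\{1,\dots,m\}$. Identify $E\otimes F$ with $F\otimes E$ through $e_i\otimes f_j=\sum_{k,l}u_{(i,j),(k,l)}\,f_l\otimes e_k$, and let $\mathcal F(E,F,u)=\bigoplus_{k,l\ge 0}E^{\otimes k}\otimes F^{\otimes l}$, with the shifts $L_{e_i}$, $L_{f_j}$ (tensoring by $e_i$, $f_j$ on the left, where $f_j\otimes E^{\otimes k}\otimes F^{\otimes l}$ is rewritten in $E^{\otimes k}\otimes F^{\otimes (l+1)}$ by means of the identification). Let $\mathcal A_u$ be the norm-closed unital algebra generated by all $L_{e_i}$, $L_{f_j}$. All generated algebras below are unital. Let $\mathcal E_n$ be the $C^*$-algebra generated by the creation operators $L_1,\dots,L_n$ on the full Fock space $H=\bigoplus_k E^{\otimes k}$. Let $X=C_m(\mathcal E_n)$ be the column space with $\langle a,b\rangle=\sum_l a_l^*b_l$, the right action $(a_l)\cdot b=(a_lb)$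 and the left action $\varphi$ of $\mathcal E_n$ determined by $\varphi(L_i)(a_j)_j=\bigl(\sum_{j,k}u_{(i,j),(k,l)}L_ka_j\bigr)_l$; it is a $C^*$-correspondence over $\mathcal E_n$. Let $\mathcal F(X)=\bigoplus_{k\ge0}X^{\otimes k}$ ($X^{\otimes0}=\mathcal E_n$, interior tensor products), let $\varphi_\infty$ be the left action of $\mathcal E_n$ on $\mathcal F(X)$, $T_x$ ($x\in X$) the creation operators on $\mathcal F(X)$, $\delta_j\in X$ the column with $I$ in place $j$ and $0$ elsewhere, and let the tensor algebra $\mathcal T_+(X)$ be the norm-closed algebra generated by $\varphi_\infty(\mathcal E_n)$ and all $T_x$. Let $Y=C_n(\mathcal E_m)$ be the analogous correspondence over $\mathcal E_m$ (acting on the Fock space $H'$ of $F$, with generators $L_{f_l}$), with left action $\varphi_Y(L_{f_l})(b_k)_k=\bigl(\sum_{j,k}\overline{u_{(i,j),(k,l)}}\,L_{f_j}b_k\bigr)_{i}$. Then: 1. There is a unitary $W:\mathcal F(X)\otimes_{\mathcal E_n}H\to\mathcal F(E,F,u)$ with $W(\varphi_\infty(L_i)\otimes I_H)=L_{e_i}W$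 and $W(T_{\delta_j}\otimes I_H)=L_{f_j}W$ for all $i,j$, such that $T\mapsto W(T\otimes I_H)W^*$ is an isometric isomorphism of the norm-closed algebra generated by the $\varphi_\infty(L_i)$ and $T_{\delta_j}$, which is a subalgebra of $\mathcal T_+(X)$, onto $\mathcal A_u$. 2. With the same $W$, $T\mapsto W(T\otimes I_H)W^*$ is an isometric isomorphism of $\mathcal T_+(X)$ onto the norm-closed algebra generated by the $L_{e_i}$, $L_{e_i}^*$ and $L_{f_j}$; this algebra contains $\mathcal A_u$. 3. There is a unitary $W':\mathcal F(Y)\otimes_{\mathcal E_m}H'\to\mathcal F(E,F,u)$ with $W'(\varphi_\infty(L_{f_j})\otimes I)=L_{f_j}W'$ and $W'(T_{\delta_i}\otimes I)=L_{e_i}W'$ for all $i,j$, such that $T\mapsto W'(T\otimes I)W'^*$ is an isometric isomorphism of $\mathcal T_+(Y)$ onto the norm-closed algebra generated by the $L_{e_i}$, $L_{f_j}$ and $L_{f_j}^*$; this algebra contains $\mathcal A_u$. -/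

import Mathlib

open scoped TensorProduct ComplexOrder

noncomputable section

namespace URA

set_option linter.unusedSectionVars false

/-- A (pre-)`C⋆`-correspondence from `A` to `B`: a complex vector space which is an `A`-`B`-bimodule,
with a `B`-valued positive semidefinite inner product (conjugate linear in the first variable,
right `B`-linear in the second one), on which `A` acts by (unital) adjointable operators.
The `C⋆`-correspondence that it presents is its Hausdorff completion with respect to the norm
`‖x‖ = ‖⟨x, x⟩‖^{1/2}`, see `PreCorr.Cpl`. The right action is written as a left action of `Bᵐᵒᵖ`. -/
structure PreCorr (A B : Type) [CStarAlgebra A] [CStarAlgebra B] [PartialOrder B] where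
  carrier : Type
  [addCommGroup : AddCommGroup carrier]
  [module : Module ℂ carrier]
  lact : A →ₐ[ℂ] Module.End ℂ carrier
  ract : Bᵐᵒᵖ →ₐ[ℂ] Module.End ℂ carrier
  ip : carrier →ₗ⋆[ℂ] carrier →ₗ[ℂ] B
  star_ip : ∀ x y, star (ip x y) = ip y x
  ip_self_nonneg : ∀ x, 0 ≤ ip x x
  ip_ract : ∀ x y b, ip x (ract (.op b) y) = ip x y * b
  ip_lact : ∀ a x y, ip (lact a x) y = ip x (lact (star a) y)
  lact_ract : ∀ a b x, lact a (ract b x) = ract b (lact a x)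

namespace PreCorr
section
variable {A B C : Type} [CStarAlgebra A] [CStarAlgebra B] [CStarAlgebra C]
  [PartialOrder A] [StarOrderedRing A] [PartialOrder B] [StarOrderedRing B]
  [PartialOrder C] [StarOrderedRing C]

instance (X : PreCorr A B) : AddCommGroup X.carrier := X.addCommGroup
instance (X : PreCorr A B) : Module ℂ X.carrier := X.module

theorem ip_ract_left (X : PreCorr A B) (x y : X.carrier) (b : B) :
    X.ip (X.ract (.op b) x) y = star b * X.ip x y := by
  rw [← X.star_ip, X.ip_ract, star_mul, X.star_ip]

theorem norm_ip_le (X : PreCorr A B) (x y : X.carrier) :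
    ‖X.ip x y‖ ^ 2 ≤ ‖X.ip x x‖ * ‖X.ip y y‖ := by
  have key : ∀ t : ℝ, ‖X.ip x x‖ < t → ‖X.ip x y‖ ^ 2 ≤ t * ‖X.ip y y‖ := by
    intro t ht
    have ht0 : 0 < t := (norm_nonneg _).trans_lt ht
    set b := X.ip x y with hb
    have h1 := X.ip_self_nonneg (X.ract (.op b) x - (t : ℂ) • y)
    have h2 : X.ip (X.ract (.op b) x - (t : ℂ) • y) (X.ract (.op b) x - (t : ℂ) • y)
        = star b * X.ip x x * b - t • (star b * b) - t • (star b * b) + t • (t • X.ip y y) := by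
      have e : X.ip y x = star b := (X.star_ip x y).symm
      have e' : X.ip x y = b := hb.symm
      have s1 : ∀ z w : X.carrier, X.ip ((t : ℂ) • z) w = t • X.ip z w := fun z w => by
        rw [map_smulₛₗ, LinearMap.smul_apply, Complex.conj_ofReal, Complex.coe_smul]
      have s2 : ∀ z w : X.carrier, X.ip z ((t : ℂ) • w) = t • X.ip z w := fun z w => by
        rw [map_smul, Complex.coe_smul]
      simp only [map_sub, LinearMap.sub_apply, ip_ract, ip_ract_left, s1, s2, e, e',
        mul_assoc]
      abel
    have h3 : star b * X.ip x x * b ≤ t • (star b * b) := by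
      refine (CStarAlgebra.star_left_conjugate_le_norm_smul
        (.of_nonneg (X.ip_self_nonneg x))).trans ?_
      exact smul_le_smul_of_nonneg_right ht.le (star_mul_self_nonneg b)
    have h4 : t • (star b * b) ≤ t • (t • X.ip y y) := by
      rw [h2] at h1
      have := h1.trans (add_le_add_left (sub_le_sub_right (sub_le_sub_right h3 _) _) _)
      simpa [sub_self, zero_sub] using this
    have h5 : star b * b ≤ t • X.ip y y := by
      rwa [smul_le_smul_iff_of_pos_left ht0] at h4
    have h6 := CStarAlgebra.norm_le_norm_of_nonneg_of_le (star_mul_self_nonneg b) h5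
    rwa [CStarRing.norm_star_mul_self, norm_smul, Real.norm_of_nonneg ht0.le, ← sq] at h6
  have hc : Filter.Tendsto (fun t : ℝ => t * ‖X.ip y y‖) (nhdsWithin ‖X.ip x x‖ (Set.Ioi ‖X.ip x x‖))
      (nhds (‖X.ip x x‖ * ‖X.ip y y‖)) :=
    (Continuous.tendsto (by fun_prop) _).mono_left nhdsWithin_le_nhds
  exact ge_of_tendsto hc (by filter_upwards [self_mem_nhdsWithin] with t ht using key t ht)

/-- The seminorm `‖x‖ = ‖⟨x, x⟩‖^{1/2}`. -/
instance (X : PreCorr A B) : Norm X.carrier := ⟨fun x => √‖X.ip x x‖⟩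

theorem norm_def (X : PreCorr A B) (x : X.carrier) : ‖x‖ = √‖X.ip x x‖ := rfl

theorem norm_sq (X : PreCorr A B) (x : X.carrier) : ‖x‖ ^ 2 = ‖X.ip x x‖ :=
  Real.sq_sqrt (norm_nonneg _)

theorem seminormCore (X : PreCorr A B) : SeminormedSpace.Core ℂ X.carrier where
  norm_nonneg _ := Real.sqrt_nonneg _
  norm_smul c x := by
    simp only [norm_def, map_smulₛₗ, LinearMap.smul_apply, RingHom.id_apply, norm_smul,
      RCLike.norm_conj, ← mul_assoc]
    rw [Real.sqrt_mul (by positivity), Real.sqrt_mul_self (norm_nonneg _)]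
  norm_triangle x y := by
    refine abs_le_of_sq_le_sq' ?_ (add_nonneg (Real.sqrt_nonneg _) (Real.sqrt_nonneg _)) |>.2
    have h : ∀ x y : X.carrier, ‖X.ip x y‖ ≤ ‖x‖ * ‖y‖ := fun x y => by
      refine abs_le_of_sq_le_sq' ?_ (mul_nonneg (Real.sqrt_nonneg _) (Real.sqrt_nonneg _)) |>.2
      rw [mul_pow]; exact (X.norm_ip_le x y).trans_eq (congrArg₂ _ (norm_sq X x) (norm_sq X y)).symm
    calc ‖x + y‖ ^ 2 = ‖X.ip x x + X.ip y x + (X.ip x y + X.ip y y)‖ := by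
          rw [norm_sq]; simp only [map_add, LinearMap.add_apply]
      _ ≤ ‖X.ip x x‖ + ‖X.ip y x‖ + (‖X.ip x y‖ + ‖X.ip y y‖) :=
          (norm_add_le _ _).trans (add_le_add (norm_add_le _ _) (norm_add_le _ _))
      _ ≤ ‖x‖ ^ 2 + ‖y‖ * ‖x‖ + (‖x‖ * ‖y‖ + ‖y‖ ^ 2) := by
          rw [norm_sq, norm_sq]; gcongr <;> exact h _ _
      _ = (‖x‖ + ‖y‖) ^ 2 := by ring

instance (X : PreCorr A B) : SeminormedAddCommGroup X.carrier :=
  .ofCore X.seminormCore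

instance (X : PreCorr A B) : NormedSpace ℂ X.carrier where
  norm_smul_le c x := (X.seminormCore.norm_smul c x).le

theorem exists_compression (M : B) (hs : IsSelfAdjoint M) : ∃ P L : B, star P = P ∧
    P * M * P = -(P * P * P) ∧ P * P * P = star L * L ∧ (P = 0 → 0 ≤ M) := by
  have hP0 : 0 ≤ M⁻ := CFC.negPart_nonneg M
  have hPs : star M⁻ = M⁻ := (IsSelfAdjoint.of_nonneg hP0).star_eq
  have hP3 : 0 ≤ M⁻ * M⁻ * M⁻ := by
    have := star_left_conjugate_nonneg hP0 M⁻
    rwa [hPs] at this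
  obtain ⟨L, hL⟩ := CStarAlgebra.nonneg_iff_eq_star_mul_self.1 hP3
  refine ⟨M⁻, L, hPs, ?_, hL, (CFC.negPart_eq_zero_iff M hs).1⟩
  have h := CFC.posPart_sub_negPart M hs
  have h2 : M⁻ * M = -(M⁻ * M⁻) := by
    calc M⁻ * M = M⁻ * (M⁺ - M⁻) := by rw [h]
      _ = _ := by rw [mul_sub, CFC.negPart_mul_posPart, zero_sub]
  rw [h2, neg_mul]

theorem exists_star_mul_self {M : B} (h : 0 ≤ M) : ∃ K : B, M = star K * K :=
  CStarAlgebra.nonneg_iff_eq_star_mul_self.1 h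

/-- A selfadjoint matrix over a `C⋆`-algebra is positive if its quadratic form is. -/
theorem matrix_nonneg {N : Type} [Fintype N] [DecidableEq N] (M : CStarMatrix N N B)
    (hM : ∀ b : N → B, 0 ≤ ∑ i, ∑ j, star (b i) * M i j * b j) (hs : IsSelfAdjoint M) : 0 ≤ M := by
  obtain ⟨P, L, hPs, hdecomp, hL, hfin⟩ := exists_compression M hs
  have hL0 : L = 0 := by
    ext i r
    have h1 : 0 ≤ (P * M * P) r r := by
      have := hM (fun i => P i r)
      convert this using 1
      simp only [CStarMatrix.mul_apply, Finset.sum_mul]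
      rw [Finset.sum_comm]
      refine Finset.sum_congr rfl fun i _ => Finset.sum_congr rfl fun j _ => ?_
      rw [← CStarMatrix.star_apply, hPs]
    have h2 : (P * P * P) r r = ∑ k, star (L k r) * L k r := by
      rw [hL, CStarMatrix.mul_apply]
      simp [CStarMatrix.star_apply]
    rw [hdecomp, CStarMatrix.neg_apply, h2, neg_nonneg] at h1
    have h3 : ∀ k ∈ Finset.univ, 0 ≤ star (L k r) * L k r := fun k _ => star_mul_self_nonneg _
    have h4 := (Finset.sum_eq_zero_iff_of_nonneg h3).1 (le_antisymm h1 (Finset.sum_nonneg h3)) i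
      (Finset.mem_univ _)
    exact (CStarRing.star_mul_self_eq_zero_iff _).1 h4
  have hP30 : P * P * P = 0 := by rw [hL, hL0]; simp
  have hPP : P * P = 0 := by
    have : star (P * P) * (P * P) = 0 := by
      rw [star_mul, hPs, ← mul_assoc, hP30, zero_mul]
    exact (CStarRing.star_mul_self_eq_zero_iff _).1 this
  have hP00 : P = 0 := by
    refine (CStarRing.star_mul_self_eq_zero_iff _).1 ?_
    rw [hPs, hPP]
  exact hfin hP00

theorem ip_lact_nonneg (X : PreCorr A B) {a : A} (ha : 0 ≤ a) (x : X.carrier) :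
    0 ≤ X.ip x (X.lact a x) := by
  obtain ⟨c, rfl⟩ := CStarAlgebra.nonneg_iff_eq_star_mul_self.1 ha
  rw [map_mul, Module.End.mul_apply, ← X.ip_lact]
  exact X.ip_self_nonneg _

theorem ip_lact_le (X : PreCorr A B) {a : A} (ha : 0 ≤ a) (x : X.carrier) :
    X.ip x (X.lact a x) ≤ ‖a‖ • X.ip x x := by
  have h := X.ip_lact_nonneg (sub_nonneg.2 (IsSelfAdjoint.le_algebraMap_norm_self (.of_nonneg ha))) x
  rw [IsScalarTower.algebraMap_apply ℝ ℂ A, map_sub, AlgHom.commutes, LinearMap.sub_apply, map_sub,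
    sub_nonneg] at h
  simpa using h


/-- The algebra `A` as a correspondence over itself: `⟨a, b⟩ = a⋆ b`, with left and right
multiplication. -/
def self (A : Type) [CStarAlgebra A] [PartialOrder A] [StarOrderedRing A] : PreCorr A A where
  carrier := A
  lact := Algebra.lmul ℂ A
  ract :=
    { toFun := fun b => LinearMap.mulRight ℂ b.unop
      map_one' := by ext; simp
      map_mul' := fun b c => by ext; simp [mul_assoc]
      map_zero' := by ext; simp
      map_add' := fun b c => by ext; simp [mul_add]
      commutes' := fun c => by ext; simp [Algebra.algebraMap_eq_smul_one] }
  ip := LinearMap.mk₂'ₛₗ (starRingEnd ℂ) (RingHom.id ℂ) (fun a b => star a * b)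
    (fun a b c => by simp [add_mul]) (fun c a b => by simp)
    (fun a b c => by simp [mul_add]) (fun c a b => by simp)
  star_ip x y := by simp
  ip_self_nonneg x := star_mul_self_nonneg x
  ip_ract x y b := by simp [mul_assoc]
  ip_lact a x y := by simp [mul_assoc]
  lact_ract a b x := by simp [mul_assoc]

/-- The semi-inner product `⟨x ⊗ y, x' ⊗ y'⟩ = ⟨y, ⟨x, x'⟩ • y'⟩` on the algebraic tensor product. -/
def tensorIp (X : PreCorr A B) (Y : PreCorr B C) :
    (X.carrier ⊗[ℂ] Y.carrier) →ₗ⋆[ℂ] (X.carrier ⊗[ℂ] Y.carrier) →ₗ[ℂ] C :=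
  TensorProduct.lift <| LinearMap.mk₂'ₛₗ (starRingEnd ℂ) (starRingEnd ℂ)
    (fun x y => TensorProduct.lift <| LinearMap.mk₂ ℂ
      (fun x' y' => Y.ip y (Y.lact (X.ip x x') y'))
      (fun _ _ _ => by simp) (fun _ _ _ => by simp) (fun _ _ _ => by simp)
      (fun _ _ _ => by simp))
    (fun _ _ _ => by ext; simp) (fun _ _ _ => by ext; simp)
    (fun _ _ _ => by ext; simp) (fun _ _ _ => by ext; simp)

theorem tensorIp_tmul (X : PreCorr A B) (Y : PreCorr B C) (x x' : X.carrier) (y y' : Y.carrier) :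
    tensorIp X Y (x ⊗ₜ y) (x' ⊗ₜ y') = Y.ip y (Y.lact (X.ip x x') y') := rfl

theorem tensorIp_self_nonneg (X : PreCorr A B) (Y : PreCorr B C) (z : X.carrier ⊗[ℂ] Y.carrier) :
    0 ≤ tensorIp X Y z z := by
  obtain ⟨N, x, y, rfl⟩ := TensorProduct.exists_sum_tmul_eq z
  let M : CStarMatrix (Fin N) (Fin N) B := CStarMatrix.ofMatrix fun i j => X.ip (x i) (x j)
  have hM : 0 ≤ M := by
    refine matrix_nonneg M (fun b => ?_) ?_
    · have h := X.ip_self_nonneg (∑ i, X.ract (.op (b i)) (x i))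
      simp only [map_sum, LinearMap.sum_apply, ip_ract, ip_ract_left] at h
      rw [Finset.sum_comm] at h
      exact h
    · ext i j
      exact X.star_ip _ _
  obtain ⟨K, hK⟩ := exists_star_mul_self hM
  have hK' : ∀ i j, X.ip (x i) (x j) = ∑ k, star (K k i) * K k j := fun i j => by
    have h1 : M i j = (star K * K) i j := by rw [hK]
    rw [CStarMatrix.mul_apply] at h1
    exact h1
  have : tensorIp X Y (∑ i, x i ⊗ₜ y i) (∑ i, x i ⊗ₜ y i) =
      ∑ k, Y.ip (∑ i, Y.lact (K k i) (y i)) (∑ i, Y.lact (K k i) (y i)) := by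
    simp only [map_sum, LinearMap.sum_apply, tensorIp_tmul, hK', map_mul, Module.End.mul_apply,
      Y.ip_lact]
    rw [Finset.sum_comm]
    refine (Finset.sum_congr rfl fun i _ => Finset.sum_comm).trans (Finset.sum_comm.trans ?_)
    exact Finset.sum_congr rfl fun k _ => Finset.sum_comm
  rw [this]
  exact Finset.sum_nonneg fun k _ => Y.ip_self_nonneg _

/-- The interior tensor product `X ⊗_B Y`: the algebraic tensor product with the semi-inner product
`⟨x ⊗ y, x' ⊗ y'⟩ = ⟨y, ⟨x, x'⟩ • y'⟩`, the left action `a • (x ⊗ y) = (a • x) ⊗ y` and the right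
action `(x ⊗ y) • c = x ⊗ (y • c)`. (The Hausdorff completion identifies `x • b ⊗ y` with
`x ⊗ b • y`.) -/
def tensor (X : PreCorr A B) (Y : PreCorr B C) : PreCorr A C where
  carrier := X.carrier ⊗[ℂ] Y.carrier
  lact := (Module.End.rTensorAlgHom ℂ X.carrier Y.carrier).comp X.lact
  ract := (Module.End.lTensorAlgHom ℂ Y.carrier X.carrier).comp Y.ract
  ip := tensorIp X Y
  star_ip z w := by
    induction z with
    | zero => simp
    | add z z' h h' => simp only [map_add, LinearMap.add_apply, star_add, h, h']
    | tmul x y =>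
      induction w with
      | zero => simp
      | add z z' h h' => simp only [map_add, LinearMap.add_apply, star_add, h, h']
      | tmul x' y' =>
        rw [tensorIp_tmul, tensorIp_tmul, Y.star_ip, Y.ip_lact, X.star_ip]
  ip_self_nonneg := tensorIp_self_nonneg X Y
  ip_ract z w c := by
    induction z with
    | zero => simp
    | add z z' h h' => simp only [map_add, LinearMap.add_apply, add_mul, h, h']
    | tmul x y =>
      induction w with
      | zero => simp
      | add z z' h h' => simp only [map_add, add_mul, h, h']
      | tmul x' y' =>
        change Y.ip y (Y.lact (X.ip x x') (Y.ract (.op c) y')) = _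
        rw [Y.lact_ract, Y.ip_ract, tensorIp_tmul]
  ip_lact a z w := by
    induction z with
    | zero => simp
    | add z z' h h' => simp only [map_add, LinearMap.add_apply, h, h']
    | tmul x y =>
      induction w with
      | zero => simp
      | add z z' h h' => rw [map_add, map_add, map_add, h, h']
      | tmul x' y' =>
        change Y.ip y (Y.lact (X.ip (X.lact a x) x') y') = Y.ip y (Y.lact (X.ip x (X.lact _ x')) y')
        rw [X.ip_lact]
  lact_ract a c z := by
    induction z with
    | zero => simp
    | add z z' h h' => rw [map_add, map_add, h, h', map_add, map_add]
    | tmul x y => rfl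

/-- The elementary tensor `x ⊗ y`. -/
def tmul (X : PreCorr A B) (Y : PreCorr B C) : X.carrier →ₗ[ℂ] Y.carrier →ₗ[ℂ] (X.tensor Y).carrier :=
  TensorProduct.mk ℂ X.carrier Y.carrier

theorem ip_tmul (X : PreCorr A B) (Y : PreCorr B C) (x x' : X.carrier) (y y' : Y.carrier) :
    (X.tensor Y).ip (tmul X Y x y) (tmul X Y x' y') = Y.ip y (Y.lact (X.ip x x') y') := rfl

/-- The semi-inner product `⟨x, y⟩ = ∑ₖ ⟨xₖ, yₖ⟩` on an algebraic direct sum. -/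
def directSumIp (X : ℕ → PreCorr A B) :
    (Π₀ k, (X k).carrier) →ₗ⋆[ℂ] (Π₀ k, (X k).carrier) →ₗ[ℂ] B :=
  have hfin : ∀ x y : Π₀ k, (X k).carrier,
      (Function.support fun k => (X k).ip (x k) (y k)).Finite := fun x y =>
    x.finite_support.subset fun k hk h => hk (by simp [h])
  LinearMap.mk₂'ₛₗ (starRingEnd ℂ) (RingHom.id ℂ)
    (fun x y => ∑ᶠ k, (X k).ip (x k) (y k))
    (fun x x' y => by
      rw [← finsum_add_distrib (hfin _ _) (hfin _ _)]; simp)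
    (fun c x y => by
      rw [smul_finsum]; simp)
    (fun x y y' => by
      rw [← finsum_add_distrib (hfin _ _) (hfin _ _)]; simp)
    (fun c x y => by
      rw [smul_finsum]; simp)

theorem directSumIp_apply (X : ℕ → PreCorr A B) (x y : Π₀ k, (X k).carrier) :
    directSumIp X x y = ∑ᶠ k, (X k).ip (x k) (y k) := rfl

theorem directSum_finite (X : ℕ → PreCorr A B) (x y : Π₀ k, (X k).carrier) :
    (Function.support fun k => (X k).ip (x k) (y k)).Finite :=
  x.finite_support.subset fun k hk h => hk (by simp [h])

/-- The direct sum of a sequence of correspondences, with the componentwise actions; its Hausdorff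
completion is the Hilbert module direct sum. -/
def directSum (X : ℕ → PreCorr A B) : PreCorr A B where
  carrier := Π₀ k, (X k).carrier
  lact :=
    { toFun := fun a => DFinsupp.mapRange.linearMap fun k => (X k).lact a
      map_one' := by ext; simp
      map_mul' := fun a b => by ext; simp
      map_zero' := by ext; simp
      map_add' := fun a b => by ext; simp
      commutes' := fun c => by ext; simp }
  ract :=
    { toFun := fun b => DFinsupp.mapRange.linearMap fun k => (X k).ract b
      map_one' := by ext; simp
      map_mul' := fun a b => by ext; simp
      map_zero' := by ext; simp
      map_add' := fun a b => by ext; simp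
      commutes' := fun c => by ext; simp [-MulOpposite.algebraMap_apply] }
  ip := directSumIp X
  star_ip x y := by
    rw [directSumIp_apply, directSumIp_apply]
    have := (starAddEquiv (R := B)).toAddMonoidHom.map_finsum (directSum_finite X x y)
    simpa [(X _).star_ip] using this
  ip_self_nonneg x := finsum_nonneg fun k => (X k).ip_self_nonneg _
  ip_ract x y b := by
    rw [directSumIp_apply, directSumIp_apply, finsum_mul' _ _ (directSum_finite X x y)]
    simp [(X _).ip_ract]
  ip_lact a x y := by
    rw [directSumIp_apply, directSumIp_apply]
    simp [(X _).ip_lact]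
  lact_ract a b x := by
    ext k
    simp [(X k).lact_ract]

/-- The inclusion of the `k`-th summand. -/
def of (X : ℕ → PreCorr A B) (k : ℕ) : (X k).carrier →ₗ[ℂ] (directSum X).carrier :=
  DFinsupp.lsingle (M := fun k => (X k).carrier) k

/-- The linear map on an algebraic direct sum given by linear maps on the summands. -/
def lift (X : ℕ → PreCorr A B) {V : Type} [AddCommGroup V] [Module ℂ V]
    (f : ∀ k, (X k).carrier →ₗ[ℂ] V) : (directSum X).carrier →ₗ[ℂ] V :=
  DFinsupp.lsum (M := fun k => (X k).carrier) ℂ f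

theorem lift_of (X : ℕ → PreCorr A B) {V : Type} [AddCommGroup V] [Module ℂ V]
    (f : ∀ k, (X k).carrier →ₗ[ℂ] V) (k : ℕ) (a : (X k).carrier) : lift X f (of X k a) = f k a :=
  DFinsupp.lsum_single (M := fun k => (X k).carrier) ℂ f k a

theorem of_induction (X : ℕ → PreCorr A B) {p : (directSum X).carrier → Prop} (h0 : p 0)
    (hof : ∀ k a, p (of X k a)) (hadd : ∀ x y, p x → p y → p (x + y)) (x) : p x :=
  DFinsupp.induction (β := fun k => (X k).carrier) x h0
    fun k a y _ _ hy => hadd _ y (hof k a) hy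

theorem ip_of (X : ℕ → PreCorr A B) (k : ℕ) (a b : (X k).carrier) :
    (directSum X).ip (of X k a) (of X k b) = (X k).ip a b := by
  change ∑ᶠ r, (X r).ip (DFinsupp.single (β := fun k => (X k).carrier) k a r)
    (DFinsupp.single (β := fun k => (X k).carrier) k b r) = _
  rw [finsum_eq_single _ k fun l hl => by rw [DFinsupp.single_eq_of_ne hl]; simp]
  simp

theorem ip_of_ne (X : ℕ → PreCorr A B) {k l : ℕ} (h : k ≠ l) (a : (X k).carrier)
    (b : (X l).carrier) : (directSum X).ip (of X k a) (of X l b) = 0 := by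
  change ∑ᶠ r, (X r).ip (DFinsupp.single (β := fun k => (X k).carrier) k a r)
    (DFinsupp.single (β := fun k => (X k).carrier) l b r) = _
  refine (finsum_congr fun r => ?_).trans finsum_zero
  by_cases hr : r = k
  · rw [DFinsupp.single_eq_of_ne (i := l) (hr.trans_ne h)]; simp
  · rw [DFinsupp.single_eq_of_ne (i := k) hr]; simp

theorem lact_of (X : ℕ → PreCorr A B) (k : ℕ) (c : A) (a : (X k).carrier) :
    (directSum X).lact c (of X k a) = of X k ((X k).lact c a) :=
  DFinsupp.mapRange_single (β₁ := fun k => (X k).carrier) (β₂ := fun k => (X k).carrier)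
    (hf := fun _ => map_zero _)

/-- The tensor powers `X^{⊗0} = A` and `X^{⊗(k+1)} = X ⊗_A X^{⊗k}`. -/
def power (X : PreCorr A A) : ℕ → PreCorr A A
  | 0 => self A
  | k + 1 => X.tensor (power X k)

/-- The full Fock correspondence `F(X) = ⨁ₖ X^{⊗k}`. -/
def fock (X : PreCorr A A) : PreCorr A A := directSum (power X)

/-- The Hausdorff completion of the underlying seminormed space. -/
abbrev Cpl (X : PreCorr A B) : Type := UniformSpace.Completion X.carrier

theorem norm_lact_le (X : PreCorr A B) (a : A) (x : X.carrier) : ‖X.lact a x‖ ≤ ‖a‖ * ‖x‖ := by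
  refine abs_le_of_sq_le_sq' ?_ (mul_nonneg (norm_nonneg _) (norm_nonneg _)) |>.2
  rw [mul_pow, X.norm_sq, X.norm_sq, X.ip_lact, ← Module.End.mul_apply, ← map_mul, sq,
    ← CStarRing.norm_star_mul_self]
  refine (CStarAlgebra.norm_le_norm_of_nonneg_of_le (X.ip_lact_nonneg (star_mul_self_nonneg a) x)
    (X.ip_lact_le (star_mul_self_nonneg a) x)).trans ?_
  rw [norm_smul, norm_norm]

/-- The left action of `a` on the completion. For `X.fock` this is `φ_∞(a) = ⨁ₖ φₖ(a)`. -/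
def leftAction (X : PreCorr A B) (a : A) : X.Cpl →L[ℂ] X.Cpl :=
  ContinuousLinearMap.completion ((X.lact a).mkContinuous ‖a‖ (X.norm_lact_le a))

theorem norm_tmul_le (X : PreCorr A B) (Y : PreCorr B C) (x : X.carrier) (y : Y.carrier) :
    ‖tmul X Y x y‖ ≤ ‖y‖ * ‖x‖ := by
  refine abs_le_of_sq_le_sq' ?_ (mul_nonneg (norm_nonneg _) (norm_nonneg _)) |>.2
  have h := X.ip_self_nonneg x
  rw [mul_pow, PreCorr.norm_sq, PreCorr.norm_sq, PreCorr.norm_sq, ip_tmul]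
  refine (CStarAlgebra.norm_le_norm_of_nonneg_of_le (Y.ip_lact_nonneg h y)
    (Y.ip_lact_le h y)).trans ?_
  rw [norm_smul, norm_norm, mul_comm]

/-- The map `ξ ↦ ξ ⊗ y`, for `ξ` in the completion of `X`, into the completion of `X ⊗_B Y`. -/
def tmulRight (X : PreCorr A B) (Y : PreCorr B C) (y : Y.carrier) : X.Cpl →L[ℂ] (X.tensor Y).Cpl :=
  ContinuousLinearMap.completion (((tmul X Y).flip y).mkContinuous ‖y‖
    fun x => norm_tmul_le X Y x y)

/-- The map `ξ ↦ x ⊗ ξ` from the `k`-th to the `(k+1)`-st tensor power. -/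
def prepend (X : PreCorr A A) (x : X.carrier) (k : ℕ) :
    (X.power k).carrier →ₗ[ℂ] (X.power (k + 1)).carrier :=
  tmul X (X.power k) x

theorem ip_prepend (X : PreCorr A A) (x : X.carrier) (k : ℕ) (a b : (X.power k).carrier) :
    (X.power (k + 1)).ip (X.prepend x k a) (X.prepend x k b) =
      (X.power k).ip a ((X.power k).lact (X.ip x x) b) := rfl

/-- The map `ξ ↦ x ⊗ ξ` on the algebraic Fock correspondence. -/
def creationAlg (X : PreCorr A A) (x : X.carrier) : X.fock.carrier →ₗ[ℂ] X.fock.carrier :=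
  lift (power X) fun k => of (power X) (k + 1) ∘ₗ X.prepend x k

theorem ip_creationAlg (X : PreCorr A A) (x : X.carrier) (ξ η : X.fock.carrier) :
    X.fock.ip (X.creationAlg x ξ) (X.creationAlg x η) = X.fock.ip ξ (X.fock.lact (X.ip x x) η) := by
  have e : ∀ k a, X.creationAlg x (of X.power k a) = of X.power (k + 1) (X.prepend x k a) :=
    fun k a => lift_of _ _ k a
  have z1 : X.creationAlg x (0 : X.fock.carrier) = 0 := map_zero _
  have z2 : X.fock.ip (0 : X.fock.carrier) = 0 := map_zero _
  have z3 : X.fock.lact (X.ip x x) (0 : X.fock.carrier) = 0 := map_zero _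
  refine of_induction X.power (p := fun ξ => X.fock.ip (X.creationAlg x ξ) (X.creationAlg x η) =
    X.fock.ip ξ (X.fock.lact (X.ip x x) η)) ?_ (fun k a => ?_) (fun ξ ξ' h h' => ?_) ξ
  · change X.fock.ip (X.creationAlg x 0) _ = X.fock.ip 0 _
    rw [z1, z2]; rfl
  · clear ξ
    refine of_induction X.power (p := fun η => X.fock.ip (X.creationAlg x (of X.power k a))
      (X.creationAlg x η) = X.fock.ip (of X.power k a) (X.fock.lact (X.ip x x) η))
      ?_ (fun l b => ?_) (fun η η' h h' => ?_) η
    · change X.fock.ip _ (X.creationAlg x 0) = X.fock.ip _ (X.fock.lact _ 0)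
      rw [z1, z3, map_zero, map_zero]
    · have h4 : X.fock.lact (X.ip x x) (of X.power l b) =
          of X.power l ((power X l).lact (X.ip x x) b) := lact_of _ l _ b
      rw [e, e, h4]
      change (directSum X.power).ip _ _ = (directSum X.power).ip _ _
      by_cases hkl : k = l
      · subst hkl
        rw [ip_of, ip_of, ip_prepend]
      · rw [ip_of_ne _ hkl, ip_of_ne _ (by omega)]
    · have h2 : X.creationAlg x (η + η') = X.creationAlg x η + X.creationAlg x η' := map_add _ η η'
      have h3 : X.fock.lact (X.ip x x) (η + η') = X.fock.lact (X.ip x x) η +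
        X.fock.lact (X.ip x x) η' := map_add _ η η'
      rw [h2, h3, map_add, map_add, h, h']
  · have h2 : X.creationAlg x (ξ + ξ') = X.creationAlg x ξ + X.creationAlg x ξ' := map_add _ ξ ξ'
    have h3 : X.fock.ip (ξ + ξ') = X.fock.ip ξ + X.fock.ip ξ' := map_add _ ξ ξ'
    rw [h2, h3, map_add, LinearMap.add_apply, LinearMap.add_apply, h, h']

theorem norm_creationAlg_le (X : PreCorr A A) (x : X.carrier) (ξ : X.fock.carrier) :
    ‖X.creationAlg x ξ‖ ≤ ‖x‖ * ‖ξ‖ := by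
  refine abs_le_of_sq_le_sq' ?_ (mul_nonneg (norm_nonneg _) (norm_nonneg _)) |>.2
  have h := X.ip_self_nonneg x
  rw [mul_pow, PreCorr.norm_sq, PreCorr.norm_sq, PreCorr.norm_sq, ip_creationAlg]
  refine (CStarAlgebra.norm_le_norm_of_nonneg_of_le (X.fock.ip_lact_nonneg h ξ)
    (X.fock.ip_lact_le h ξ)).trans ?_
  rw [norm_smul, norm_norm]

/-- The creation operator `T_x` on the Fock module `F(X)`. -/
def creation (X : PreCorr A A) (x : X.carrier) : X.fock.Cpl →L[ℂ] X.fock.Cpl :=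
  ContinuousLinearMap.completion ((X.creationAlg x).mkContinuous ‖x‖ (X.norm_creationAlg_le x))

/-- The tensor algebra `T₊(X)`: the norm-closed algebra of operators on `F(X)` that is generated by
`φ_∞(a)`, `a ∈ A`, and `T_x`, `x ∈ X`. -/
def tensorAlgebra (X : PreCorr A A) : Subalgebra ℂ (X.fock.Cpl →L[ℂ] X.fock.Cpl) :=
  (Algebra.adjoin ℂ (Set.range X.fock.leftAction ∪ Set.range X.creation)).topologicalClosure

end
end PreCorr

variable {n m : ℕ}

/-- The Hilbert space `ℓ²(ι)`. -/
abbrev L2 (ι : Type) : Type := lp (fun _ : ι => ℂ) 2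

open Classical in
/-- The standard basis vectors of `ℓ²(ι)`. -/
def stdVec {ι : Type} (i : ι) : L2 ι := lp.single 2 i 1

open Classical in
theorem inner_stdVec {ι : Type} (i j : ι) :
    inner ℂ (stdVec i) (stdVec j) = if i = j then (1 : ℂ) else 0 := by
  rw [stdVec, lp.inner_single_left, stdVec, lp.single_apply]
  by_cases h : i = j
  · subst h; simp
  · simp [h]

theorem orthonormal_of_inner {ι κ : Type} (b : ι → L2 κ) [DecidableEq ι]
    (hb : ∀ i j, inner ℂ (b i) (b j) = if i = j then (1 : ℂ) else 0) : Orthonormal ℂ b :=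
  orthonormal_iff_ite.2 hb

/-- The isometry `ℓ²(ι) → ℓ²(κ)` that sends the standard basis to the orthonormal family `b`. -/
def isom {ι κ : Type} (b : ι → L2 κ) (hb : Orthonormal ℂ b) : L2 ι →L[ℂ] L2 κ :=
  hb.orthogonalFamily.linearIsometry.toContinuousLinearMap

theorem isom_stdVec {ι κ : Type} (b : ι → L2 κ) (hb : Orthonormal ℂ b) (i : ι) :
    isom b hb (stdVec i) = b i := by
  classical
  have := hb.orthogonalFamily.linearIsometry_apply_single (i := i) (1 : ℂ)
  rw [LinearIsometry.toSpanSingleton_apply, one_smul] at this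
  rw [← this, stdVec, isom]
  simp only [LinearIsometry.coe_toContinuousLinearMap]

theorem inner_isom {ι κ : Type} (b : ι → L2 κ) (hb : Orthonormal ℂ b) (x y : L2 ι) :
    inner ℂ (isom b hb x) (isom b hb y) = inner ℂ x y :=
  hb.orthogonalFamily.linearIsometry.inner_map_map x y

theorem clm_ext {ι : Type} {E : Type} [NormedAddCommGroup E] [NormedSpace ℂ E]
    {S T : L2 ι →L[ℂ] E} (h : ∀ i, S (stdVec i) = T (stdVec i)) : S = T := by
  classical
  ext x
  have hx := lp.hasSum_single (E := fun _ : ι => ℂ) (p := 2) (by simp) x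
  have key : ∀ i, S (lp.single 2 i (x i)) = T (lp.single 2 i (x i)) := fun i => by
    have e : lp.single (E := fun _ : ι => ℂ) 2 i (x i) = x i • stdVec i := by
      rw [stdVec, ← lp.single_smul]
      simp only [smul_eq_mul, mul_one]
    rw [e, map_smul, map_smul, h]
  refine (S.hasSum hx).unique ?_
  simp only [key]
  exact T.hasSum hx

theorem vec_ext {ι : Type} {x y : L2 ι} (h : ∀ i, inner ℂ (stdVec i) x = inner ℂ (stdVec i) y) :
    x = y := by
  classical
  ext i
  have := h i
  rw [stdVec, lp.inner_single_left, lp.inner_single_left] at this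
  simpa using this

theorem orthonormal_stdVec {ι κ : Type} {f : ι → κ} (hf : Function.Injective f) :
    Orthonormal ℂ fun i => (stdVec (f i) : L2 κ) := by
  classical
  refine orthonormal_iff_ite.2 fun i j => ?_
  rw [inner_stdVec]
  by_cases h : i = j
  · simp [h]
  · simp [h, hf.ne h]

/-- The full Fock space `⨁ₖ (ℂⁿ)^{⊗k}`. The word `w = i₁ ⋯ iₖ` indexes the basis vector
`e_w = e_{i₁} ⊗ ⋯ ⊗ e_{iₖ}`. -/
abbrev Fock (n : ℕ) : Type := L2 (List (Fin n))

/-- The creation operator `e_w ↦ e_i ⊗ e_w`. -/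
def shift {n : ℕ} (i : Fin n) : Fock n →L[ℂ] Fock n :=
  isom (fun w => stdVec (i :: w)) (orthonormal_stdVec fun _ _ h => (List.cons.inj h).2)

theorem shift_stdVec {n : ℕ} (i : Fin n) (w : List (Fin n)) :
    shift i (stdVec w) = stdVec (i :: w) := isom_stdVec _ _ _

/-- The Fock space `F(n, m, u) = ⨁_{k, l} (ℂⁿ)^{⊗k} ⊗ (ℂᵐ)^{⊗l}`. The pair of words `(w, v)` indexes
the basis vector `e_w ⊗ f_v`. -/
abbrev Fock₂ (n m : ℕ) : Type := L2 (List (Fin n) × List (Fin m))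

variable {n m : ℕ}

/-- The shift `L_{e_i}`: `e_w ⊗ f_v ↦ e_i ⊗ e_w ⊗ f_v`. -/
def shiftE (m : ℕ) (i : Fin n) : Fock₂ n m →L[ℂ] Fock₂ n m :=
  isom (fun p => stdVec (i :: p.1, p.2)) (orthonormal_stdVec fun p q h => by
    simp only [Prod.mk.injEq, List.cons.injEq, true_and] at h
    exact Prod.ext h.1 h.2)

theorem shiftE_stdVec (i : Fin n) (w : List (Fin n)) (v : List (Fin m)) :
    shiftE m i (stdVec (w, v)) = stdVec (i :: w, v) := isom_stdVec _ _ _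

theorem inner_shiftE (i i' : Fin n) (x y : Fock₂ n m) :
    inner ℂ (shiftE m i x) (shiftE m i' y) = if i = i' then inner ℂ x y else (0 : ℂ) := by
  split_ifs with h
  · subst h; exact inner_isom _ _ x y
  · have : (shiftE m i).adjoint ∘L shiftE m i' = 0 := clm_ext fun p => vec_ext fun q => by
      classical
      rw [ContinuousLinearMap.comp_apply, ContinuousLinearMap.adjoint_inner_right,
        ← Prod.mk.eta (p := p), ← Prod.mk.eta (p := q), shiftE_stdVec, shiftE_stdVec, inner_stdVec]
      simp [h]
    rw [← ContinuousLinearMap.adjoint_inner_right, ← ContinuousLinearMap.comp_apply, this]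
    simp

/-- The vector `f_l ⊗ e_w ⊗ f_v`, written in `(ℂⁿ)^{⊗k} ⊗ (ℂᵐ)^{⊗l}` through successive applications of
`f_l ⊗ e_k = ∑_{i, j} conj (u_{(i,j),(k,l)}) e_i ⊗ f_j`, which (as `u` is unitary) is the
identification `e_i ⊗ f_j = ∑_{k, l} u_{(i,j),(k,l)} f_l ⊗ e_k`. -/
def frontF (u : Matrix.unitaryGroup (Fin n × Fin m) ℂ) :
    List (Fin n) → List (Fin m) → Fin m → Fock₂ n m
  | [], v, l => stdVec ([], l :: v)
  | k :: w, v, l => ∑ i : Fin n, ∑ j : Fin m, star (u.1 (i, j) (k, l)) • shiftE m i (frontF u w v j)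

theorem unitary_col (u : Matrix.unitaryGroup (Fin n × Fin m) ℂ) (p q : Fin n × Fin m) :
    ∑ i : Fin n, ∑ j : Fin m, u.1 (i, j) p * star (u.1 (i, j) q) =
      if p = q then 1 else 0 := by
  have h := congrFun (congrFun (Matrix.mem_unitaryGroup_iff'.1 u.2) q) p
  rw [Matrix.mul_apply, Matrix.one_apply, Fintype.sum_prod_type] at h
  simp only [Matrix.star_apply] at h
  simpa only [mul_comm, eq_comm] using h

theorem unitary_row (u : Matrix.unitaryGroup (Fin n × Fin m) ℂ) (p q : Fin n × Fin m) :
    ∑ k : Fin n, ∑ l : Fin m, u.1 p (k, l) * star (u.1 q (k, l)) =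
      if p = q then 1 else 0 := by
  have h := congrFun (congrFun (Matrix.mem_unitaryGroup_iff.1 u.2) p) q
  rw [Matrix.mul_apply, Matrix.one_apply, Fintype.sum_prod_type] at h
  simpa only [Matrix.star_apply] using h

theorem inner_shiftE_nil (i : Fin n) (x : Fock₂ n m) (v : List (Fin m)) :
    inner ℂ (stdVec ([], v)) (shiftE m i x) = (0 : ℂ) := by
  have : (shiftE m i).adjoint (stdVec ([], v)) = 0 := vec_ext fun q => by
    classical
    rw [ContinuousLinearMap.adjoint_inner_right, ← Prod.mk.eta (p := q), shiftE_stdVec,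
      inner_stdVec]
    simp
  rw [← ContinuousLinearMap.adjoint_inner_left, this, inner_zero_left]

theorem inner_frontF (u : Matrix.unitaryGroup (Fin n × Fin m) ℂ) (w w' : List (Fin n))
    (v v' : List (Fin m)) (l l' : Fin m) :
    inner ℂ (frontF u w v l) (frontF u w' v' l') =
      if w = w' ∧ v = v' ∧ l = l' then (1 : ℂ) else 0 := by
  classical
  induction w generalizing w' l l' with
  | nil =>
    cases w' with
    | nil => simp [frontF, inner_stdVec, and_comm]
    | cons k' w' => simp [frontF, inner_sum, inner_smul_right, inner_shiftE_nil]
  | cons k w ih =>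
    cases w' with
    | nil =>
      rw [← inner_conj_symm]
      simp [frontF, inner_sum, inner_smul_right, inner_shiftE_nil]
    | cons k' w' =>
      simp only [frontF, inner_sum, sum_inner, inner_smul_left, inner_smul_right, inner_shiftE, ih]
      have h := unitary_col u (k, l) (k', l')
      have h1 : ∀ (x : Fin n) (y : Fin m), (∑ a : Fin n, ∑ b : Fin m,
          (starRingEnd ℂ) (star (u.1 (a, b) (k, l))) *
            if a = x then if w = w' ∧ v = v' ∧ b = y then 1 else 0 else 0) =
          u.1 (x, y) (k, l) * if w = w' ∧ v = v' then 1 else 0 := fun x y => by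
        rw [Finset.sum_eq_single x (fun a _ ha => by simp [ha]) (by simp),
          Finset.sum_eq_single y (fun b _ hb => by simp [hb]) (by simp)]
        simp
      simp only [h1]
      have h2 : (∑ x : Fin n, ∑ y : Fin m, star (u.1 (x, y) (k', l')) *
          (u.1 (x, y) (k, l) * if w = w' ∧ v = v' then 1 else 0)) =
          (∑ x : Fin n, ∑ y : Fin m, u.1 (x, y) (k, l) * star (u.1 (x, y) (k', l'))) *
            if w = w' ∧ v = v' then 1 else 0 := by
        simp only [Finset.sum_mul]
        exact Finset.sum_congr rfl fun x _ => Finset.sum_congr rfl fun y _ => by ring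
      rw [h2, h]
      simp only [Prod.mk.injEq, List.cons.injEq, mul_ite, mul_one, mul_zero]
      split_ifs <;> first | rfl | (exfalso; tauto)

/-- The shift `L_{f_l}`: `e_w ⊗ f_v ↦ f_l ⊗ e_w ⊗ f_v`. -/
def shiftF (u : Matrix.unitaryGroup (Fin n × Fin m) ℂ) (l : Fin m) : Fock₂ n m →L[ℂ] Fock₂ n m :=
  isom (fun p => frontF u p.1 p.2 l) <| orthonormal_iff_ite.2 fun p q => by
    rw [inner_frontF]
    simp [Prod.ext_iff]

theorem shiftF_stdVec (u : Matrix.unitaryGroup (Fin n × Fin m) ℂ) (l : Fin m) (w : List (Fin n))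
    (v : List (Fin m)) : shiftF u l (stdVec (w, v)) = frontF u w v l := isom_stdVec _ _ _

/-- The algebra `A_u`: the norm-closed unital algebra generated by the `L_{e_i}` and the `L_{f_j}`. -/
def algA (u : Matrix.unitaryGroup (Fin n × Fin m) ℂ) : Subalgebra ℂ (Fock₂ n m →L[ℂ] Fock₂ n m) :=
  (Algebra.adjoin ℂ (Set.range (shiftE m) ∪ Set.range (shiftF u))).topologicalClosure

/-- The norm-closed unital algebra generated by the `L_{e_i}`, the `L_{e_i}⋆` and the `L_{f_j}`. -/
def algE (u : Matrix.unitaryGroup (Fin n × Fin m) ℂ) : Subalgebra ℂ (Fock₂ n m →L[ℂ] Fock₂ n m) :=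
  (Algebra.adjoin ℂ (Set.range (shiftE m) ∪ Set.range (fun i : Fin n => star (shiftE m i)) ∪
    Set.range (shiftF u))).topologicalClosure

/-- The norm-closed unital algebra generated by the `L_{e_i}`, the `L_{f_j}⋆` and the `L_{f_j}`. -/
def algF (u : Matrix.unitaryGroup (Fin n × Fin m) ℂ) : Subalgebra ℂ (Fock₂ n m →L[ℂ] Fock₂ n m) :=
  (Algebra.adjoin ℂ (Set.range (shiftE m) ∪ Set.range (fun j : Fin m => star (shiftF u j)) ∪
    Set.range (shiftF u))).topologicalClosure

/-- The Cuntz–Toeplitz algebra: the unital `C⋆`-algebra generated by the creation operators on the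
full Fock space. -/
def toeplitz (n : ℕ) : StarSubalgebra ℂ (Fock n →L[ℂ] Fock n) :=
  (StarAlgebra.adjoin ℂ (Set.range (shift (n := n)))).topologicalClosure

instance : IsClosed (toeplitz n : Set (Fock n →L[ℂ] Fock n)) := isClosed_closure


/-- The order of the `C⋆`-algebra, for which the positive elements are those of the form `a⋆ a`. -/
instance : PartialOrder (toeplitz n) := CStarAlgebra.spectralOrder _
instance : StarOrderedRing (toeplitz n) := CStarAlgebra.spectralOrderedRing _

theorem shift_mem (i : Fin n) : shift i ∈ toeplitz n :=
  StarSubalgebra.le_topologicalClosure _ (StarAlgebra.subset_adjoin ℂ _ ⟨i, rfl⟩)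

/-- The generators `L_i`. -/
def gen (i : Fin n) : toeplitz n := ⟨shift i, shift_mem i⟩

/-- The isometry `h ↦ h ⊗ f_v`. -/
def rightTensor (v : List (Fin m)) : Fock n →L[ℂ] Fock₂ n m :=
  isom (fun w => stdVec (w, v)) (orthonormal_stdVec fun _ _ h => (Prod.mk.inj h).1)

theorem rightTensor_stdVec (v : List (Fin m)) (w : List (Fin n)) :
    rightTensor v (stdVec w) = stdVec (w, v) := isom_stdVec _ _ _

open ContinuousLinearMap in
theorem adjoint_rightTensor_stdVec (v v' : List (Fin m)) (w : List (Fin n)) :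
    (rightTensor v).adjoint (stdVec (w, v')) = if v = v' then stdVec w else 0 := vec_ext fun q => by
  classical
  rw [adjoint_inner_right, rightTensor_stdVec, inner_stdVec]
  split_ifs with h1 h2 h2 <;> simp_all only [inner_stdVec, Prod.mk.injEq, and_self, and_true, true_and, and_false, inner_zero_right, not_true_eq_false, if_true, if_false]

open ContinuousLinearMap in
theorem adjoint_rightTensor_shiftE (v : List (Fin m)) (i : Fin n) (x : Fock₂ n m) :
    (rightTensor v).adjoint (shiftE m i x) = shift i ((rightTensor v).adjoint x) := by
  have : (rightTensor v).adjoint ∘L shiftE m i = shift i ∘L (rightTensor v).adjoint :=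
    clm_ext fun p => by
      obtain ⟨w, v'⟩ := p
      rw [comp_apply, comp_apply, shiftE_stdVec, adjoint_rightTensor_stdVec,
        adjoint_rightTensor_stdVec]
      split_ifs
      · rw [shift_stdVec]
      · simp
  exact DFunLike.congr_fun this x

/-- The matrix `V` of the unitary `F ⊗ H → H ⊗ F`, for `H` the Fock space of `ℂⁿ`, that is given by the
identification: `f_l ⊗ h = ∑_r V_{r,l} h ⊗ f_r`. -/
def flipMat (u : Matrix.unitaryGroup (Fin n × Fin m) ℂ) :
    Matrix (Fin m) (Fin m) (Fock n →L[ℂ] Fock n) :=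
  Matrix.of fun r l => (rightTensor [r]).adjoint ∘L shiftF u l ∘L rightTensor []

theorem flipMat_nil (u : Matrix.unitaryGroup (Fin n × Fin m) ℂ) (r l : Fin m) :
    flipMat u r l (stdVec []) = if r = l then stdVec [] else 0 := by
  simp [flipMat, rightTensor_stdVec, shiftF_stdVec, frontF, adjoint_rightTensor_stdVec]

theorem flipMat_cons (u : Matrix.unitaryGroup (Fin n × Fin m) ℂ) (r l : Fin m) (k : Fin n)
    (w : List (Fin n)) : flipMat u r l (stdVec (k :: w)) =
      ∑ i : Fin n, ∑ j : Fin m, star (u.1 (i, j) (k, l)) • shift i (flipMat u r j (stdVec w)) := by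
  simp [flipMat, rightTensor_stdVec, shiftF_stdVec, frontF, adjoint_rightTensor_shiftE]

theorem sum_rightTensor_frontF (u : Matrix.unitaryGroup (Fin n × Fin m) ℂ) (w : List (Fin n))
    (l : Fin m) : frontF u w [] l =
      ∑ r, rightTensor [r] ((rightTensor [r]).adjoint (frontF u w [] l)) := by
  have hE : ∀ (r : Fin m) (i : Fin n) (x : Fock n),
      rightTensor [r] (shift i x) = shiftE m i (rightTensor [r] x) := fun r i x => by
    have : rightTensor [r] ∘L shift i = shiftE m i ∘L rightTensor [r] := clm_ext fun w => by
      simp [rightTensor_stdVec, shiftE_stdVec, shift_stdVec]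
    exact DFunLike.congr_fun this x
  induction w generalizing l with
  | nil => simp [frontF, adjoint_rightTensor_stdVec, apply_ite, rightTensor_stdVec]
  | cons k w ih =>
    simp only [frontF, map_sum, map_smul, adjoint_rightTensor_shiftE, hE]
    refine Eq.trans (Finset.sum_congr rfl fun i _ => ?_) Finset.sum_comm
    refine Eq.trans (Finset.sum_congr rfl fun j _ => ?_) Finset.sum_comm
    rw [← Finset.smul_sum, ← map_sum, ← ih]

theorem flipMat_stdVec (u : Matrix.unitaryGroup (Fin n × Fin m) ℂ) (r l : Fin m)
    (w : List (Fin n)) :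
    flipMat u r l (stdVec w) = (rightTensor [r]).adjoint (frontF u w [] l) := by
  simp [flipMat, rightTensor_stdVec, shiftF_stdVec]

open ContinuousLinearMap in
theorem star_flipMat_mul (u : Matrix.unitaryGroup (Fin n × Fin m) ℂ) :
    star (flipMat u) * flipMat u = 1 := by
  classical
  ext1 l l'
  have e1 : (star (flipMat u) * flipMat u) l l' =
      ∑ r, (flipMat u r l).adjoint ∘L flipMat u r l' := Matrix.mul_apply
  rw [e1, Matrix.one_apply]
  refine clm_ext fun w' => vec_ext fun w => ?_
  have h := inner_frontF u w w' [] [] l l'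
  rw [sum_rightTensor_frontF u w' l', inner_sum] at h
  rw [sum_apply, inner_sum]
  calc _ = ∑ r, inner ℂ (frontF u w [] l)
        (rightTensor [r] ((rightTensor [r]).adjoint (frontF u w' [] l'))) :=
        Finset.sum_congr rfl fun r _ => by
          rw [comp_apply, adjoint_inner_right, flipMat_stdVec, flipMat_stdVec, adjoint_inner_left]
    _ = _ := by
      rw [h]
      by_cases hl : l = l'
      · simp only [hl, if_true, one_apply_eq_self, inner_stdVec, and_true]
        congr
      · simp [hl]

theorem clm_mul_apply {E : Type} [NormedAddCommGroup E] [NormedSpace ℂ E] (S T : E →L[ℂ] E)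
    (x : E) : (S * T) x = S (T x) := rfl

theorem shift_flipMat (u : Matrix.unitaryGroup (Fin n × Fin m) ℂ) (i : Fin n) (r j : Fin m) :
    shift i * flipMat u r j =
      ∑ l : Fin m, flipMat u r l * ∑ k : Fin n, u.1 (i, j) (k, l) • shift k := by
  classical
  refine clm_ext fun w => ?_
  have e : (∑ l : Fin m, flipMat u r l * ∑ k : Fin n, u.1 (i, j) (k, l) • shift k) (stdVec w) =
      ∑ i' : Fin n, ∑ j' : Fin m, (∑ k : Fin n, ∑ l : Fin m,
        u.1 (i, j) (k, l) * star (u.1 (i', j') (k, l))) • shift i' (flipMat u r j' (stdVec w)) := by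
    have h1 : ∀ l : Fin m, (flipMat u r l * ∑ k : Fin n, u.1 (i, j) (k, l) • shift k) (stdVec w) =
        ∑ k : Fin n, ∑ i' : Fin n, ∑ j' : Fin m, (u.1 (i, j) (k, l) * star (u.1 (i', j') (k, l))) •
          shift i' (flipMat u r j' (stdVec w)) := fun l => by
      rw [clm_mul_apply, sum_apply, map_sum]
      refine Finset.sum_congr rfl fun k _ => ?_
      rw [smul_apply, shift_stdVec, map_smul, flipMat_cons]
      simp only [Finset.smul_sum, mul_smul]
    rw [sum_apply]
    simp only [h1, Finset.sum_smul]
    rw [Finset.sum_comm]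
    refine (Finset.sum_congr rfl fun k _ => Finset.sum_comm).trans (Finset.sum_comm.trans ?_)
    refine Finset.sum_congr rfl fun i' _ => ?_
    refine (Finset.sum_congr rfl fun k _ => Finset.sum_comm).trans Finset.sum_comm
  rw [e]
  simp only [unitary_row, Prod.mk.injEq]
  rw [Finset.sum_eq_single i (fun a _ ha => by simp [Ne.symm ha]) (by simp),
    Finset.sum_eq_single j (fun b _ hb => by simp [Ne.symm hb]) (by simp)]
  simp

theorem flipMat_mul_star (u : Matrix.unitaryGroup (Fin n × Fin m) ℂ) :
    flipMat u * star (flipMat u) = 1 := by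
  classical
  set V := flipMat u with hV
  set P := V * star V with hP
  have hPV : P * V = V := by rw [hP, mul_assoc, star_flipMat_mul, mul_one]
  let D : Fin n → Matrix (Fin m) (Fin m) (Fock n →L[ℂ] Fock n) :=
    fun i => Matrix.diagonal fun _ => shift i
  have hD : ∀ i, ∃ S, D i * V = V * S := fun i =>
    ⟨Matrix.of fun l j => ∑ k : Fin n, u.1 (i, j) (k, l) • shift k, by
      ext1 r j
      rw [Matrix.diagonal_mul, shift_flipMat, Matrix.mul_apply]
      rfl⟩
  have hPD : ∀ i, P * D i * P = D i * P := fun i => by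
    obtain ⟨S, hS⟩ := hD i
    calc P * D i * P = P * (D i * V) * star V := by rw [hP]; simp only [mul_assoc]
      _ = P * V * S * star V := by rw [hS]; simp only [mul_assoc]
      _ = D i * P := by rw [hPV, ← hS, hP]; simp only [mul_assoc]
  have key : ∀ (w : List (Fin n)) (r s : Fin m),
      P r s (stdVec w) = if r = s then stdVec w else 0 := by
    intro w
    induction w with
    | nil =>
      intro r s
      have h := DFunLike.congr_fun (congrFun (congrFun hPV r) s) (stdVec ([] : List (Fin n)))
      rw [Matrix.mul_apply, sum_apply, Finset.sum_eq_single s] at h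
      · simpa [hV, flipMat_nil] using h
      · intro b _ hb
        simp [hV, flipMat_nil, hb]
      · simp
    | cons k w ih =>
      intro r s
      have h := DFunLike.congr_fun (congrFun (congrFun (hPD k) r) s) (stdVec w)
      rw [Matrix.mul_apply, sum_apply, Finset.sum_eq_single s] at h
      · simp only [D, Matrix.diagonal_mul, Matrix.mul_diagonal] at h
        rw [clm_mul_apply, clm_mul_apply, clm_mul_apply, ih, ih, if_pos rfl, shift_stdVec] at h
        rw [h]
        split_ifs <;> simp [shift_stdVec]
      · intro b _ hb
        rw [clm_mul_apply, ih, if_neg hb, map_zero]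
      · simp
  ext1 r s
  refine clm_ext fun w => ?_
  rw [key, Matrix.one_apply]
  split_ifs <;> simp

/-- The homomorphism `a ↦ V⋆ (a ⊗ 1) V`. -/
def conjFlip (u : Matrix.unitaryGroup (Fin n × Fin m) ℂ) :
    (Fock n →L[ℂ] Fock n) →⋆ₐ[ℂ] Matrix (Fin m) (Fin m) (Fock n →L[ℂ] Fock n) where
  toFun a := star (flipMat u) * Matrix.diagonal (fun _ => a) * flipMat u
  map_one' := by simp [star_flipMat_mul]
  map_mul' a b := by
    rw [← Matrix.diagonal_mul_diagonal]
    calc _ = star (flipMat u) * Matrix.diagonal (fun _ => a) * 1 * Matrix.diagonal (fun _ => b) *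
        flipMat u := by simp only [mul_assoc, one_mul]
      _ = _ := by rw [← flipMat_mul_star u]; simp only [mul_assoc]
  map_zero' := by simp
  map_add' a b := by rw [← Matrix.diagonal_add, mul_add, add_mul]
  commutes' c := by
    have : (Matrix.diagonal fun _ : Fin m => algebraMap ℂ (Fock n →L[ℂ] Fock n) c) =
        algebraMap ℂ (Matrix (Fin m) (Fin m) (Fock n →L[ℂ] Fock n)) c := by
      rw [Matrix.algebraMap_eq_diagonal]; rfl
    rw [this, ← Algebra.commutes, mul_assoc, star_flipMat_mul, mul_one]
  map_star' a := by
    simp [Matrix.star_eq_conjTranspose, mul_assoc]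
    rfl

theorem conjFlip_apply (u : Matrix.unitaryGroup (Fin n × Fin m) ℂ) (a : Fock n →L[ℂ] Fock n)
    (l j : Fin m) : conjFlip u a l j = ∑ r, star (flipMat u r l) * a * flipMat u r j := by
  change (star (flipMat u) * Matrix.diagonal (fun _ => a) * flipMat u : Matrix _ _ _) l j = _
  rw [Matrix.mul_apply]
  simp only [Matrix.mul_diagonal, Matrix.star_apply]

theorem conjFlip_shift (u : Matrix.unitaryGroup (Fin n × Fin m) ℂ) (i : Fin n) (l j : Fin m) :
    conjFlip u (shift i) l j = ∑ k : Fin n, u.1 (i, j) (k, l) • shift k := by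
  have h : (Matrix.diagonal fun _ => shift i) * flipMat u =
      flipMat u * Matrix.of fun l j => ∑ k : Fin n, u.1 (i, j) (k, l) • shift k := by
    ext1 r j
    rw [Matrix.diagonal_mul, shift_flipMat, Matrix.mul_apply]
    rfl
  change (star (flipMat u) * Matrix.diagonal (fun _ => shift i) * flipMat u : Matrix _ _ _) l j = _
  rw [mul_assoc, h, ← mul_assoc, star_flipMat_mul, one_mul]
  rfl

theorem conjFlip_mem (u : Matrix.unitaryGroup (Fin n × Fin m) ℂ) {a : Fock n →L[ℂ] Fock n}
    (ha : a ∈ toeplitz n) (l j : Fin m) : conjFlip u a l j ∈ toeplitz n := by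
  have hcl : IsClosed (toeplitz n : Set (Fock n →L[ℂ] Fock n)) := isClosed_closure
  have hcont : Continuous fun a => conjFlip u a l j := by
    simp only [conjFlip_apply]
    fun_prop
  have hmaps : Set.MapsTo (fun a => conjFlip u a l j)
      (StarAlgebra.adjoin ℂ (Set.range (shift (n := n))) : Set (Fock n →L[ℂ] Fock n))
      (toeplitz n) := by
    intro b hb
    have hb' : ∀ l j, conjFlip u b l j ∈ toeplitz n := by
      induction hb using StarAlgebra.adjoin_induction with
      | mem x hx =>
        obtain ⟨i, rfl⟩ := hx
        intro l j
        rw [conjFlip_shift]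
        exact sum_mem fun k _ => SMulMemClass.smul_mem _ (shift_mem k)
      | algebraMap c =>
        intro l j
        rw [AlgHomClass.commutes, Matrix.algebraMap_matrix_apply]
        split_ifs
        · exact algebraMap_mem _ _
        · exact zero_mem _
      | add x y _ _ hx hy =>
        intro l j
        rw [map_add]; exact add_mem (hx l j) (hy l j)
      | mul x y _ _ hx hy =>
        intro l j
        rw [map_mul, Matrix.mul_apply]
        exact sum_mem fun k _ => mul_mem (hx l k) (hy k j)
      | star x _ hx =>
        intro l j
        rw [map_star, Matrix.star_apply]
        exact star_mem (hx j l)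
    exact hb' l j
  have := hmaps.closure hcont ha
  rwa [hcl.closure_eq] at this

/-- The `⋆`-homomorphism `φ : E_n → M_m(E_n)` with `φ(L_i)_{l,j} = ∑ₖ u_{(i,j),(k,l)} L_k`, see
`twist_gen`. (As `E_n` is generated by the `L_i` as a `C⋆`-algebra, this determines it.) -/
def twist (u : Matrix.unitaryGroup (Fin n × Fin m) ℂ) :
    toeplitz n →⋆ₐ[ℂ] Matrix (Fin m) (Fin m) (toeplitz n) where
  toFun a := Matrix.of fun l j => ⟨conjFlip u a l j, conjFlip_mem u a.2 l j⟩
  map_one' := by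
    refine Matrix.ext fun l j => Subtype.ext ?_
    simp [Matrix.one_apply]
    split_ifs <;> rfl
  map_mul' a b := by
    refine Matrix.ext fun l j => Subtype.ext ?_
    simp [Matrix.mul_apply]
  map_zero' := by refine Matrix.ext fun l j => Subtype.ext ?_; simp
  map_add' a b := by refine Matrix.ext fun l j => Subtype.ext ?_; simp
  commutes' c := by
    refine Matrix.ext fun l j => Subtype.ext ?_
    change conjFlip u (algebraMap ℂ (Fock n →L[ℂ] Fock n) c) l j = _
    rw [AlgHomClass.commutes, Matrix.algebraMap_matrix_apply, Matrix.algebraMap_matrix_apply]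
    split_ifs <;> rfl
  map_star' a := by
    refine Matrix.ext fun l j => Subtype.ext ?_
    change conjFlip u (star (a : Fock n →L[ℂ] Fock n)) l j = _
    rw [map_star]
    rfl

theorem twist_gen (u : Matrix.unitaryGroup (Fin n × Fin m) ℂ) (i : Fin n) (l j : Fin m) :
    twist u (gen i) l j = ∑ k : Fin n, u.1 (i, j) (k, l) • gen k := by
  refine Subtype.ext ((conjFlip_shift u i l j).trans ?_)
  rw [AddSubmonoidClass.coe_finsetSum]
  rfl

/-- The column space `C_m(A)`, with `⟨a, b⟩ = ∑ₗ aₗ⋆ bₗ`, the right action `(aₗ) • b = (aₗ b)`, and the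
left action by matrices that is given by a `⋆`-homomorphism `A → M_m(A)`. -/
def columnOf {A : Type} [CStarAlgebra A] [PartialOrder A] [StarOrderedRing A]
    (θ : A →⋆ₐ[ℂ] Matrix (Fin m) (Fin m) A) : PreCorr A A where
  carrier := Fin m → A
  lact :=
    { toFun := fun a =>
        { toFun := fun x => (θ a).mulVec x
          map_add' := fun x y => Matrix.mulVec_add _ x y
          map_smul' := fun c x => Matrix.mulVec_smul _ c x }
      map_one' := by refine LinearMap.ext fun x => ?_; simp
      map_mul' := fun a b => by
        refine LinearMap.ext fun x => ?_
        simp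
      map_zero' := by refine LinearMap.ext fun x => ?_; simp
      map_add' := fun a b => by
        refine LinearMap.ext fun x => ?_
        simp [Matrix.add_mulVec]
      commutes' := fun c => by
        refine LinearMap.ext fun x => ?_
        simp [Algebra.algebraMap_eq_smul_one, Matrix.smul_mulVec] }
  ract :=
    { toFun := fun b =>
        { toFun := fun x l => x l * b.unop
          map_add' := fun x y => by ext1 l; simp [add_mul]
          map_smul' := fun c x => by ext1 l; simp }
      map_one' := by refine LinearMap.ext fun x => funext fun l => ?_; simp
      map_mul' := fun a b => by
        refine LinearMap.ext fun x => funext fun l => ?_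
        simp [mul_assoc]
      map_zero' := by refine LinearMap.ext fun x => funext fun l => ?_; simp
      map_add' := fun a b => by
        refine LinearMap.ext fun x => funext fun l => ?_
        simp [mul_add]
      commutes' := fun c => by
        refine LinearMap.ext fun x => funext fun l => ?_
        simp [Algebra.algebraMap_eq_smul_one] }
  ip := LinearMap.mk₂'ₛₗ (starRingEnd ℂ) (RingHom.id ℂ) (fun x y => ∑ l, star (x l) * y l)
    (fun _ _ _ => by simp [add_mul, Finset.sum_add_distrib])
    (fun _ _ _ => by simp [Finset.smul_sum])
    (fun _ _ _ => by simp [mul_add, Finset.sum_add_distrib])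
    (fun _ _ _ => by simp [Finset.smul_sum])
  star_ip x y := by simp
  ip_self_nonneg x := by
    change 0 ≤ ∑ l, star (x l) * x l
    exact Finset.sum_nonneg fun l _ => star_mul_self_nonneg (x l)
  ip_ract x y b := by simp [Finset.sum_mul, mul_assoc]
  ip_lact a x y := by
    simp only [LinearMap.mk₂'ₛₗ_apply, AlgHom.coe_mk, RingHom.coe_mk, MonoidHom.coe_mk,
      OneHom.coe_mk, LinearMap.coe_mk, AddHom.coe_mk, map_star, Matrix.mulVec, dotProduct,
      Matrix.star_apply, star_sum, star_mul, Finset.sum_mul, Finset.mul_sum]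
    rw [Finset.sum_comm]
    simp only [mul_assoc]
  lact_ract a b x := by
    refine funext fun l => ?_
    simp [Matrix.mulVec, dotProduct, Finset.sum_mul, mul_assoc]

/-- The correspondence `X = C_m(E_n)` over `E_n` with the `u`-twisted left action. -/
def column (u : Matrix.unitaryGroup (Fin n × Fin m) ℂ) : PreCorr (toeplitz n) (toeplitz n) :=
  columnOf (twist u)

/-- The left action of `L_i`: `(a_j)_j ↦ (∑_{j, k} u_{(i,j),(k,l)} L_k a_j)_l`. -/
theorem column_lact_gen (u : Matrix.unitaryGroup (Fin n × Fin m) ℂ) (i : Fin n)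
    (a : Fin m → toeplitz n) (l : Fin m) :
    ((column u).lact (gen i) a : Fin m → toeplitz n) l =
      ∑ j : Fin m, ∑ k : Fin n, u.1 (i, j) (k, l) • (gen k * a j) := by
  change ∑ j, twist u (gen i) l j * a j = _
  simp [twist_gen, Finset.sum_mul]

/-- The vector `δ_j` in the column space, with `1` in place `j` and `0` elsewhere. -/
def colUnit (u : Matrix.unitaryGroup (Fin n × Fin m) ℂ) (j : Fin m) : (column u).carrier :=
  (Pi.single j 1 : Fin m → toeplitz n)

/-- A representation `π` of `A` on a Hilbert space `H`, as a correspondence from `A` to `ℂ`. -/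
def ofRep {A H : Type} [CStarAlgebra A] [PartialOrder A] [StarOrderedRing A]
    [NormedAddCommGroup H] [InnerProductSpace ℂ H] [CompleteSpace H]
    (π : A →⋆ₐ[ℂ] (H →L[ℂ] H)) : PreCorr A ℂ where
  carrier := H
  lact :=
    { toFun := fun a => (π a : H →ₗ[ℂ] H)
      map_one' := by rw [map_one]; rfl
      map_mul' := fun _ _ => by rw [map_mul]; rfl
      map_zero' := by rw [map_zero]; rfl
      map_add' := fun _ _ => by rw [map_add]; rfl
      commutes' := fun c => by
        rw [AlgHomClass.commutes]; ext; simp [Algebra.algebraMap_eq_smul_one] }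
  ract :=
    { toFun := fun b => b.unop • LinearMap.id
      map_one' := by ext1 x; simp
      map_mul' := fun a b => by
        refine LinearMap.ext fun x => ?_
        change (b.unop * a.unop) • x = a.unop • (b.unop • x)
        rw [smul_smul, mul_comm]
      map_zero' := by ext1 x; simp
      map_add' := fun a b => by ext1 x; simp [add_smul]
      commutes' := fun c => by ext1 x; simp }
  ip := innerₛₗ ℂ
  star_ip x y := inner_conj_symm y x
  ip_self_nonneg x := by
    have : inner ℂ x x = ((‖x‖ ^ 2 : ℝ) : ℂ) := by simp [inner_self_eq_norm_sq_to_K (𝕜 := ℂ) x]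
    rw [innerₛₗ_apply_apply, this]
    exact_mod_cast sq_nonneg ‖x‖
  ip_ract x y b := by simp [mul_comm]
  ip_lact a x y := by
    change inner ℂ (π a x) y = inner ℂ x (π (star a) y)
    rw [map_star, ContinuousLinearMap.star_eq_adjoint, ContinuousLinearMap.adjoint_inner_right]
  lact_ract a b x := by simp

/-- The Fock space, on which the Cuntz–Toeplitz algebra acts by its identity representation. -/
def fockRep (n : ℕ) : PreCorr (toeplitz n) ℂ := ofRep (toeplitz n).subtype

/-- The unitary `u'` with `u'_{(l,k),(j,i)} = conj (u_{(i,j),(k,l)})`, which describes the commutation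
relations after an exchange of the roles of `E = ℂⁿ` and `F = ℂᵐ`. -/
def swapU (u : Matrix.unitaryGroup (Fin n × Fin m) ℂ) : Matrix.unitaryGroup (Fin m × Fin n) ℂ :=
  ⟨Matrix.of fun p q => star (u.1 (q.2, q.1) (p.2, p.1)), by
    have h := Matrix.mem_unitaryGroup_iff'.1 u.2
    rw [Matrix.mem_unitaryGroup_iff]
    ext p q
    have h' := congrFun (congrFun h (p.2, p.1)) (q.2, q.1)
    rw [Matrix.mul_apply, Fintype.sum_prod_type, Finset.sum_comm] at h'
    rw [Matrix.mul_apply, Fintype.sum_prod_type]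
    simpa [Matrix.star_apply, Matrix.one_apply, Prod.ext_iff, and_comm] using h'⟩

/-- The closed subalgebra of `T₊(X)` generated by the `φ_∞(L_i)` and the `T_{δ_j}`, for
`X = C_m(E_n)`. -/
def analyticSub (u : Matrix.unitaryGroup (Fin n × Fin m) ℂ) :
    Subalgebra ℂ ((column u).fock.Cpl →L[ℂ] (column u).fock.Cpl) :=
  (Algebra.adjoin ℂ (Set.range (fun i : Fin n => (column u).fock.leftAction (gen i)) ∪
    Set.range (fun j : Fin m => (column u).creation (colUnit u j)))).topologicalClosure

/-- The unitary `W : F(X) ⊗_A Y → K` implements an isometric isomorphism of the algebra `𝓑` of operators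
on `F(X)` onto the algebra `𝓒` of operators on `K`, namely `T ↦ W (T ⊗ I) W⋆`. (The vectors
`ξ ⊗ h` span a dense subspace, so the displayed equation determines `Φ T`.) -/
def Implements {A : Type} [CStarAlgebra A] [PartialOrder A] [StarOrderedRing A]
    {X : PreCorr A A} {Y : PreCorr A ℂ} {K : Type} [NormedAddCommGroup K] [InnerProductSpace ℂ K]
    (W : (X.fock.tensor Y).Cpl ≃ₗᵢ[ℂ] K) (𝓑 : Subalgebra ℂ (X.fock.Cpl →L[ℂ] X.fock.Cpl))
    (𝓒 : Subalgebra ℂ (K →L[ℂ] K)) : Prop :=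
  ∃ Φ : 𝓑 ≃ₐ[ℂ] 𝓒, Isometry Φ ∧ ∀ (T : 𝓑) (h : Y.carrier) (ξ : X.fock.Cpl),
    (Φ T : K →L[ℂ] K) (W (PreCorr.tmulRight X.fock Y h ξ)) =
      W (PreCorr.tmulRight X.fock Y h ((T : X.fock.Cpl →L[ℂ] X.fock.Cpl) ξ))

end URA

end

noncomputable section

namespace URA

open PreCorr

/-! An element of `X` is a column `x = ∑ δ_j x_j`, and `δ_j a ⊗ ξ = δ_j ⊗ a ξ` in an interior tensor
product. So `X ⊗ X^{⊗k}` is `m` copies of `X^{⊗k}`, and the only sensible map of `F(X) ⊗ H` into a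
space with operators `E i`, `F j` is `a ⊗ h ↦ vac (a h)` in degree zero and `(x ⊗ ξ) ⊗ h ↦ ∑ F j
((x_j ξ) ⊗ h)` above. The axioms of `FockModel` are exactly what makes this a unitary that carries
`φ_∞(L_i) ⊗ I` to `E i` and `T_{δ_j} ⊗ I` to `F j`. Orthogonality of the ranges gives the inner
products (`inner_powMap`, `inner_powMap_of_ne`), the commutation relation is the formula for the
left action on `X` (`powMap_lact_gen`), and cyclicity of the vacuum gives density of the range
(`denseRange_fockMap_vacuum`).

For the algebras, `T` and `T ⊗ I` must have the same norm. One inequality holds because `E_n` is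
faithful on `H`, so `‖ξ‖` is the supremum of `‖ξ ⊗ h‖` over unit vectors `h` (`norm_le_of_embed`).
The other is the inequality `⟨T ξ, T ξ⟩ ≤ ‖T‖² ⟨ξ, ξ⟩` for bounded right module maps
(`norm_apply_le_of_commute`). It suffices to use it for the vectors `ξ ⊗ Ω`, as these are already
dense. The operators `T ⊗ I` need not be constructed for every `T`: the intertwined pairs `(T, S)`
form a closed algebra on which both projections are isometric, so it is the graph of an isomorphism
as soon as each generator has a partner in the other algebra (`exists_algEquiv_of_intertwined`).

The partners are visible for `φ_∞(L_i)` and `T_{δ_j}`. For the whole tensor algebra, `T_x ⊗ I = ∑ F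
j (x_j ⊗ I)`, where `a ↦ a ⊗ I` is a contractive representation of `E_n` on `K` that respects
adjoints; hence its image lies in the closed algebra generated by the `E i` and their adjoints.

The Fock space of `(E, F, u)` is a model in two ways: over the Fock space of `E` with matrix `u`,
and, with the roles of the shifts exchanged, over the Fock space of `F` with matrix `swapU u`. -/

/-- Operators `E i`, `F j` on a Hilbert space `K` that satisfy the commutation relations given by `u`,
where the `E i` act on the space `vac (Fock n)` as the creation operators, the `F j` are isometries
with orthogonal ranges that are orthogonal to `vac (Fock n)`, and the vacuum vector is cyclic. -/
structure FockModel {n m : ℕ} (u : Matrix.unitaryGroup (Fin n × Fin m) ℂ) (K : Type)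
    [NormedAddCommGroup K] [InnerProductSpace ℂ K] where
  E : Fin n → K →L[ℂ] K
  F : Fin m → K →L[ℂ] K
  vac : Fock n →L[ℂ] K
  inner_F : ∀ j l x y, inner ℂ (F j x) (F l y) = if j = l then inner ℂ x y else 0
  inner_vac : ∀ x y, inner ℂ (vac x) (vac y) = inner ℂ x y
  inner_vac_F : ∀ j x y, inner ℂ (vac x) (F j y) = 0
  vac_shift : ∀ i x, vac (shift i x) = E i (vac x)
  E_F : ∀ i j x, E i (F j x) = ∑ l, ∑ k, u.1 (i, j) (k, l) • F l (E k x)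
  dense_of_invariant : ∀ M : Submodule ℂ K, vac (stdVec []) ∈ M →
    (∀ i, ∀ x ∈ M, E i x ∈ M) → (∀ j, ∀ x ∈ M, F j x ∈ M) → Dense (M : Set K)

/-! ### Elementary tensors and coordinates of columns -/

/-- The inclusion of `A` as the zeroth tensor power. -/
def toPowerZero {A : Type} [CStarAlgebra A] [PartialOrder A] [StarOrderedRing A] (X : PreCorr A A)
    (a : A) : (X.power 0).carrier := a

/-- The inclusion of the `k`-th tensor power into the Fock correspondence. -/
def ofPower {A : Type} [CStarAlgebra A] [PartialOrder A] [StarOrderedRing A] (X : PreCorr A A)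
    (k : ℕ) : (X.power k).carrier →ₗ[ℂ] X.fock.carrier := of X.power k

theorem power_induction {A : Type} [CStarAlgebra A] [PartialOrder A] [StarOrderedRing A]
    {X : PreCorr A A} {k : ℕ} {p : (X.power (k + 1)).carrier → Prop} (zero : p 0)
    (prepend : ∀ x ξ, p (X.prepend x k ξ)) (add : ∀ x y, p x → p y → p (x + y)) (z) : p z :=
  TensorProduct.induction_on z zero prepend add

theorem fock_induction {A : Type} [CStarAlgebra A] [PartialOrder A] [StarOrderedRing A]
    {X : PreCorr A A} {p : X.fock.carrier → Prop} (zero : p 0)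
    (of : ∀ k a, p (ofPower X k a)) (add : ∀ x y, p x → p y → p (x + y)) (x) : p x :=
  of_induction X.power zero of add x

theorem lact_ofPower {A : Type} [CStarAlgebra A] [PartialOrder A] [StarOrderedRing A]
    (X : PreCorr A A) (k : ℕ) (a : A) (ξ : (X.power k).carrier) :
    X.fock.lact a (ofPower X k ξ) = ofPower X k ((X.power k).lact a ξ) :=
  lact_of _ k a ξ

theorem ract_ofPower {A : Type} [CStarAlgebra A] [PartialOrder A] [StarOrderedRing A]
    (X : PreCorr A A) (k : ℕ) (a : A) (ξ : (X.power k).carrier) :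
    X.fock.ract (.op a) (ofPower X k ξ) = ofPower X k ((X.power k).ract (.op a) ξ) :=
  DFinsupp.mapRange_single (β₁ := fun k => (X.power k).carrier)
    (β₂ := fun k => (X.power k).carrier) (hf := fun _ => map_zero _)

theorem creationAlg_ofPower {A : Type} [CStarAlgebra A] [PartialOrder A] [StarOrderedRing A]
    (X : PreCorr A A) (x : X.carrier) (k : ℕ) (ξ : (X.power k).carrier) :
    X.creationAlg x (ofPower X k ξ) = ofPower X (k + 1) (X.prepend x k ξ) := lift_of _ _ _ _

theorem tensor_induction {A B C : Type} [CStarAlgebra A] [CStarAlgebra B] [CStarAlgebra C]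
    [PartialOrder A] [StarOrderedRing A] [PartialOrder B] [StarOrderedRing B]
    [PartialOrder C] [StarOrderedRing C]
    {X : PreCorr A B} {Y : PreCorr B C}
    {p : (X.tensor Y).carrier → Prop} (zero : p 0)
    (tmul : ∀ x ξ, p (tmul X Y x ξ)) (add : ∀ x y, p x → p y → p (x + y)) (z) : p z :=
  TensorProduct.induction_on z zero tmul add

/-- The `j`-th coordinate of a column. -/
def coord {n m : ℕ} (u : Matrix.unitaryGroup (Fin n × Fin m) ℂ) (j : Fin m) :
    (column u).carrier →ₗ[ℂ] toeplitz n where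
  toFun x := (x : Fin m → toeplitz n) j
  map_add' _ _ := rfl
  map_smul' _ _ := rfl

theorem coord_lact_gen {n m : ℕ} (u : Matrix.unitaryGroup (Fin n × Fin m) ℂ) (i : Fin n)
    (x : (column u).carrier) (l : Fin m) : coord u l ((column u).lact (gen i) x) =
      ∑ j : Fin m, ∑ k : Fin n, u.1 (i, j) (k, l) • (gen k * coord u j x) :=
  column_lact_gen u i x l

theorem coord_colUnit {n m : ℕ} (u : Matrix.unitaryGroup (Fin n × Fin m) ℂ) (j l : Fin m) :
    coord u l (colUnit u j) = if l = j then 1 else 0 :=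
  Pi.single_apply j (1 : toeplitz n) l

theorem ip_lact_sum {A B ι : Type} [CStarAlgebra A] [PartialOrder A] [StarOrderedRing A]
    [CStarAlgebra B] [PartialOrder B] [StarOrderedRing B] (X : PreCorr A B) (s : Finset ι)
    (a b : ι → A) (ξ η : X.carrier) : X.ip ξ (X.lact (∑ l ∈ s, star (a l) * b l) η) =
      ∑ l ∈ s, X.ip (X.lact (a l) ξ) (X.lact (b l) η) := by
  rw [map_sum, LinearMap.sum_apply, map_sum]
  refine Finset.sum_congr rfl fun l _ => ?_
  rw [PreCorr.ip_lact, map_mul, Module.End.mul_apply]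

/-- Since `⟨x, y⟩ = ∑ x_l⋆ y_l`, the assignment `x ⊗ ξ ↦ (x_l ξ)_l` preserves inner products: the
next tensor power embeds in `m` orthogonal copies of the previous one. -/
theorem ip_prepend_prepend {n m : ℕ} (u : Matrix.unitaryGroup (Fin n × Fin m) ℂ) (k : ℕ)
    (x y : (column u).carrier) (ξ η : ((column u).power k).carrier) :
    ((column u).power (k + 1)).ip ((column u).prepend x k ξ) ((column u).prepend y k η) =
      ∑ l, ((column u).power k).ip (((column u).power k).lact (coord u l x) ξ)
        (((column u).power k).lact (coord u l y) η) :=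
  ip_lact_sum ((column u).power k) Finset.univ (fun l => coord u l x) (fun l => coord u l y) ξ η

theorem inner_coe_sum {n : ℕ} {ι : Type} (s : Finset ι) (a : ι → toeplitz n) (x y : Fock n) :
    inner ℂ x ((∑ l ∈ s, a l).1 y) = ∑ l ∈ s, inner ℂ x ((a l).1 y) := by
  rw [AddSubmonoidClass.coe_finsetSum, sum_apply, inner_sum]

theorem inner_star_apply {n : ℕ} (a : toeplitz n) (x y : Fock n) :
    inner ℂ x ((star a : toeplitz n).1 y) = inner ℂ (a.1 x) y := by
  rw [StarMemClass.coe_star, ContinuousLinearMap.star_eq_adjoint,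
    ContinuousLinearMap.adjoint_inner_right]

/-! ### The isometry of `F(X) ⊗ H` onto a dense subspace of a model -/

namespace FockModel

variable {n m : ℕ} {u : Matrix.unitaryGroup (Fin n × Fin m) ℂ} {K : Type}
  [NormedAddCommGroup K] [InnerProductSpace ℂ K] (M : FockModel u K)

theorem inner_sum_F (x y : Fin m → K) :
    inner ℂ (∑ j, M.F j (x j)) (∑ j, M.F j (y j)) = ∑ j, inner ℂ (x j) (y j) := by
  rw [sum_inner]
  refine Finset.sum_congr rfl fun l _ => ?_
  rw [inner_sum, Finset.sum_eq_single l (fun j _ hj => by rw [M.inner_F, if_neg hj.symm])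
    (by simp), M.inner_F, if_pos rfl]

/-- The map `(x, ξ) ↦ ∑ⱼ Fⱼ (f (xⱼ • ξ))`. -/
def succMap (k : ℕ) (f : ((column u).power k).carrier →ₗ[ℂ] Fock n →ₗ[ℂ] K) :
    (column u).carrier →ₗ[ℂ] ((column u).power k).carrier →ₗ[ℂ] Fock n →ₗ[ℂ] K :=
  LinearMap.mk₂ ℂ (fun x ξ => ∑ j, (M.F j : K →ₗ[ℂ] K) ∘ₗ
      f (((column u).power k).lact (coord u j x) ξ))
    (fun x y ξ => by
      simp only [map_add, LinearMap.add_apply, LinearMap.comp_add, Finset.sum_add_distrib])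
    (fun c x ξ => by
      simp only [map_smul, LinearMap.smul_apply, LinearMap.comp_smul, Finset.smul_sum])
    (fun x ξ η => by
      simp only [map_add, LinearMap.comp_add, Finset.sum_add_distrib])
    (fun c x ξ => by
      simp only [map_smul, LinearMap.comp_smul, Finset.smul_sum])

/-- The map `ξ ↦ (h ↦ ξ ⊗ h)` from the `k`-th tensor power of the column correspondence into the
linear maps from the Fock space of `ℂⁿ` to `K`. -/
def powMap : (k : ℕ) → ((column u).power k).carrier →ₗ[ℂ] Fock n →ₗ[ℂ] K
  -- In degree zero, `a ⊗ h` is the vector `a h`, placed in the vacuum space.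
  | 0 => ((LinearMap.llcomp ℂ (Fock n) (Fock n) K (M.vac : Fock n →ₗ[ℂ] K)) ∘ₗ
      (ContinuousLinearMap.coeLM ℂ) ∘ₗ ((toeplitz n).subtype.toAlgHom.toLinearMap) :
      toeplitz n →ₗ[ℂ] Fock n →ₗ[ℂ] K)
  | k + 1 => TensorProduct.lift (succMap M k (powMap k))

theorem powMap_prepend (k : ℕ) (x : (column u).carrier) (ξ : ((column u).power k).carrier)
    (h : Fock n) : M.powMap (k + 1) ((column u).prepend x k ξ) h =
      ∑ j, M.F j (M.powMap k (((column u).power k).lact (coord u j x) ξ) h) := by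
  change (∑ j, (M.F j : K →ₗ[ℂ] K) ∘ₗ
      M.powMap k (((column u).power k).lact (coord u j x) ξ)) h = _
  rw [LinearMap.sum_apply]
  rfl

/-- The isometries `F j` have orthogonal ranges, so the inner product in degree `k + 1` is a sum of
inner products in degree `k` over the coordinates, which is also how `ip_prepend_prepend` computes
it in the tensor power. -/
theorem inner_powMap (k : ℕ) (ξ η : ((column u).power k).carrier) (h g : Fock n) :
    inner ℂ (M.powMap k ξ h) (M.powMap k η g) =
      inner ℂ h ((((column u).power k).ip ξ η).1 g) := by
  induction k generalizing h g with
  | zero =>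
    change inner ℂ (M.vac ((show toeplitz n from ξ).1 h)) (M.vac ((show toeplitz n from η).1 g)) =
      inner ℂ h ((star (show toeplitz n from ξ) * (show toeplitz n from η)).1 g)
    rw [M.inner_vac, ← inner_star_apply]
    rfl
  | succ k ih =>
    induction ξ using power_induction with
    | zero => simp
    | add ξ ξ' h1 h2 => simp [h1, h2]
    | prepend x ξ =>
      induction η using power_induction with
      | zero => simp
      | add η η' h1 h2 => simp [h1, h2]
      | prepend y η =>
        have e := ip_prepend_prepend u k x y ξ η
        have e1 := M.powMap_prepend k x ξ h
        have e2 := M.powMap_prepend k y η g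
        rw [e]
        refine (congrArg₂ (inner ℂ) e1 e2).trans ((M.inner_sum_F _ _).trans
          (Eq.trans ?_ (inner_coe_sum _ _ h g).symm))
        exact Finset.sum_congr rfl fun l _ => ih _ _ h g

/-- The degree counts the operators `F j` in front of the vacuum space. They are cancelled in pairs
until one side has none left, and then a vector of the vacuum space meets the range of some `F j`,
which is orthogonal to it (`h0`). -/
theorem inner_powMap_of_ne {k l : ℕ} (hkl : k ≠ l) (ξ : ((column u).power k).carrier)
    (η : ((column u).power l).carrier) (h g : Fock n) :
    inner ℂ (M.powMap k ξ h) (M.powMap l η g) = 0 := by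
  have h0 : ∀ k (a : ((column u).power 0).carrier) (ξ : ((column u).power (k + 1)).carrier) h g,
      inner ℂ (M.powMap 0 a h) (M.powMap (k + 1) ξ g) = 0 := fun k a ξ h g => by
    induction ξ using power_induction with
    | zero => simp
    | add ξ ξ' h1 h2 => simp [h1, h2]
    | prepend x ξ =>
      rw [powMap_prepend, inner_sum]
      exact Finset.sum_eq_zero fun j _ => M.inner_vac_F _ _ _
  induction k generalizing l h g with
  | zero =>
    cases l with
    | zero => exact absurd rfl hkl
    | succ l => exact h0 l ξ η h g
  | succ k ih =>
    cases l with
    | zero => rw [← inner_conj_symm, h0 k η ξ g h, map_zero]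
    | succ l =>
      induction ξ using power_induction with
      | zero => simp
      | add ξ ξ' h1 h2 => simp [h1, h2]
      | prepend x ξ =>
        induction η using power_induction with
        | zero => simp
        | add η η' h1 h2 => simp [h1, h2]
        | prepend y η =>
          rw [powMap_prepend, powMap_prepend, sum_inner]
          refine Finset.sum_eq_zero fun j _ => ?_
          rw [inner_sum]
          refine Finset.sum_eq_zero fun j' _ => ?_
          rw [M.inner_F, ih (by omega), ite_self]

/-- Moving `E i` past `F j` produces the coefficients `u_{(i,j),(k,l)}` by which `L_i` acts on a
column, and the operator `E k` left over acts one degree lower. -/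
theorem powMap_lact_gen (k : ℕ) (i : Fin n) (ξ : ((column u).power k).carrier) (h : Fock n) :
    M.powMap k (((column u).power k).lact (gen i) ξ) h = M.E i (M.powMap k ξ h) := by
  induction k generalizing i h with
  | zero => exact M.vac_shift i _
  | succ k ih =>
    induction ξ using power_induction with
    | zero => simp
    | add ξ ξ' h1 h2 => simp only [map_add, LinearMap.add_apply, h1, h2]
    | prepend x ξ =>
      change M.powMap (k + 1) ((column u).prepend ((column u).lact (gen i) x) k ξ) h = _
      rw [powMap_prepend, powMap_prepend, map_sum]
      simp only [coord_lact_gen, M.E_F, map_sum, map_smul, LinearMap.sum_apply,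
        LinearMap.smul_apply, map_mul, Module.End.mul_apply]
      refine Finset.sum_comm.trans (Finset.sum_congr rfl fun j _ => Finset.sum_congr rfl fun l _ =>
        Finset.sum_congr rfl fun k' _ => ?_)
      exact congrArg (fun x => _ • M.F l x) (ih k' _ h)

/-- This is the balancing `ξ b ⊗ h = ξ ⊗ b h`; it allows vectors of the Fock module to be normalized
at the expense of `h`. -/
theorem powMap_ract (k : ℕ) (b : toeplitz n) (ξ : ((column u).power k).carrier) (h : Fock n) :
    M.powMap k (((column u).power k).ract (.op b) ξ) h = M.powMap k ξ (b.1 h) := by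
  induction k generalizing h with
  | zero => rfl
  | succ k ih =>
    induction ξ using power_induction with
    | zero => simp
    | add ξ ξ' h1 h2 => simp only [map_add, LinearMap.add_apply, h1, h2]
    | prepend x ξ =>
      change M.powMap (k + 1) ((column u).prepend x k (((column u).power k).ract (.op b) ξ)) h = _
      simp only [powMap_prepend, PreCorr.lact_ract, ih]

/-- The map `ξ ↦ (h ↦ ξ ⊗ h)` from the algebraic Fock correspondence into the linear maps from the
Fock space of `ℂⁿ` to `K`. -/
def fockMap : (column u).fock.carrier →ₗ[ℂ] Fock n →ₗ[ℂ] K := lift (column u).power M.powMap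

theorem fockMap_of (k : ℕ) (ξ : ((column u).power k).carrier) :
    M.fockMap (ofPower _ k ξ) = M.powMap k ξ := lift_of _ _ _ _

theorem inner_fockMap (ξ η : (column u).fock.carrier) (h g : Fock n) :
    inner ℂ (M.fockMap ξ h) (M.fockMap η g) = inner ℂ h (((column u).fock.ip ξ η).1 g) := by
  induction ξ using fock_induction with
  | zero => simp
  | add ξ ξ' h1 h2 => simp [h1, h2]
  | of k ξ =>
    induction η using fock_induction with
    | zero => simp
    | add η η' h1 h2 => simp [h1, h2]
    | of l η =>
      rw [fockMap_of, fockMap_of]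
      change _ = inner ℂ h (((directSum (column u).power).ip (of (column u).power k ξ)
        (of (column u).power l η)).1 g)
      by_cases hkl : k = l
      · subst hkl
        rw [ip_of, inner_powMap]
      · rw [ip_of_ne _ hkl, inner_powMap_of_ne _ hkl]
        simp

theorem fockMap_lact_gen (i : Fin n) (ξ : (column u).fock.carrier) (h : Fock n) :
    M.fockMap ((column u).fock.lact (gen i) ξ) h = M.E i (M.fockMap ξ h) := by
  induction ξ using fock_induction with
  | zero => simp
  | add ξ ξ' h1 h2 => simp only [map_add, LinearMap.add_apply, h1, h2]
  | of k ξ => rw [lact_ofPower, fockMap_of, fockMap_of, powMap_lact_gen]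

theorem fockMap_ract (b : toeplitz n) (ξ : (column u).fock.carrier) (h : Fock n) :
    M.fockMap ((column u).fock.ract (.op b) ξ) h = M.fockMap ξ (b.1 h) := by
  induction ξ using fock_induction with
  | zero => simp
  | add ξ ξ' h1 h2 => simp only [map_add, LinearMap.add_apply, h1, h2]
  | of k ξ => rw [ract_ofPower, fockMap_of, fockMap_of, powMap_ract]

theorem fockMap_creationAlg (x : (column u).carrier) (ξ : (column u).fock.carrier) (h : Fock n) :
    M.fockMap ((column u).creationAlg x ξ) h =
      ∑ j, M.F j (M.fockMap ((column u).fock.lact (coord u j x) ξ) h) := by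
  induction ξ using fock_induction with
  | zero => simp
  | add ξ ξ' h1 h2 => simp only [map_add, LinearMap.add_apply, h1, h2, Finset.sum_add_distrib]
  | of k ξ => simp only [creationAlg_ofPower, lact_ofPower, fockMap_of, powMap_prepend]

theorem fockMap_creationAlg_colUnit (j : Fin m) (ξ : (column u).fock.carrier) (h : Fock n) :
    M.fockMap ((column u).creationAlg (colUnit u j) ξ) h = M.F j (M.fockMap ξ h) := by
  rw [fockMap_creationAlg, Finset.sum_eq_single j]
  · simp [coord_colUnit]
  · intro l _ hl
    simp [coord_colUnit, hl]
  · simp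

/-- Every vector of `K` is a limit of vectors of the form `ξ ⊗ Ω`. -/
theorem denseRange_fockMap_vacuum :
    DenseRange fun ξ : (column u).fock.carrier => M.fockMap ξ (stdVec []) := by
  have h := M.dense_of_invariant (LinearMap.range (M.fockMap.flip (stdVec [])))
    -- The vacuum is `1 ⊗ Ω`. The range is invariant under `E i` and `F j`, as these act through
    -- `φ_∞(L_i)` and `T_{δ_j}` on the first factor.
    ⟨ofPower _ 0 (toPowerZero _ 1), by
      rw [LinearMap.flip_apply, fockMap_of]; rfl⟩
    (by
      rintro i _ ⟨ξ, rfl⟩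
      exact ⟨_, M.fockMap_lact_gen i ξ _⟩)
    (by
      rintro j _ ⟨ξ, rfl⟩
      exact ⟨_, M.fockMap_creationAlg_colUnit j ξ _⟩)
  exact h

/-- The map `ξ ⊗ h ↦ fockMap ξ h`. -/
def tensorMap : ((column u).fock.tensor (fockRep n)).carrier →ₗ[ℂ] K :=
  TensorProduct.lift (show (column u).fock.carrier →ₗ[ℂ] (fockRep n).carrier →ₗ[ℂ] K from M.fockMap)

theorem tensorMap_tmul (ξ : (column u).fock.carrier) (h : (fockRep n).carrier) :
    M.tensorMap (tmul _ _ ξ h) = M.fockMap ξ h := rfl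

theorem inner_tensorMap (z w : ((column u).fock.tensor (fockRep n)).carrier) :
    inner ℂ (M.tensorMap z) (M.tensorMap w) =
      ((column u).fock.tensor (fockRep n)).ip z w := by
  induction z using tensor_induction with
  | zero => simp
  | add z z' h1 h2 => simp only [map_add, inner_add_left, LinearMap.add_apply, h1, h2]
  | tmul ξ h =>
    induction w using tensor_induction with
    | zero => simp
    | add w w' h1 h2 => simp only [map_add, inner_add_right, h1, h2]
    | tmul η g => exact M.inner_fockMap ξ η h g

theorem norm_tensorMap (z : ((column u).fock.tensor (fockRep n)).carrier) :
    ‖M.tensorMap z‖ = ‖z‖ := by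
  rw [PreCorr.norm_def, ← M.inner_tensorMap, @norm_eq_sqrt_re_inner ℂ, inner_self_re_eq_norm]

theorem denseRange_tensorMap : DenseRange M.tensorMap := by
  refine M.denseRange_fockMap_vacuum.mono ?_
  rintro _ ⟨ξ, rfl⟩
  exact ⟨tmul _ _ ξ (stdVec [] : Fock n), M.tensorMap_tmul _ _⟩

theorem norm_fockMap_sq (ξ : (column u).fock.carrier) (h : Fock n) :
    ‖M.fockMap ξ h‖ ^ 2 = (inner ℂ h (((column u).fock.ip ξ ξ).1 h)).re := by
  rw [← M.inner_fockMap]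
  exact (inner_self_eq_norm_sq (𝕜 := ℂ) _).symm

/-- Writing `⟨ξ, ξ⟩ = a⋆ a` gives `‖ξ ⊗ h‖ = ‖a h‖` and `‖ξ‖ = ‖a‖`. The norm of `a` is its operator
norm on the Fock space, so it is controlled by the vectors `ξ ⊗ h`. -/
theorem norm_coe_le_of_embed (ξ : (column u).fock.carrier) {c : ℝ} (hc : 0 ≤ c)
    (h : ∀ h, ‖M.fockMap ξ h‖ ≤ c * ‖h‖) : ‖ξ‖ ≤ c := by
  obtain ⟨a, ha⟩ := exists_star_mul_self ((column u).fock.ip_self_nonneg ξ)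
  have h1 : ‖a.1‖ ≤ c := ContinuousLinearMap.opNorm_le_bound _ hc fun x => by
    refine le_trans (le_of_eq ?_) (h x)
    refine (sq_eq_sq₀ (norm_nonneg _) (norm_nonneg _)).1 ?_
    rw [norm_fockMap_sq, ha]
    change _ = (inner ℂ x ((star a : toeplitz n).1 (a.1 x))).re
    rw [inner_star_apply]
    exact (inner_self_eq_norm_sq (𝕜 := ℂ) _).symm
  refine abs_le_of_sq_le_sq' ?_ hc |>.2
  rw [PreCorr.norm_sq, ha, CStarRing.norm_star_mul_self, ← sq]
  exact pow_le_pow_left₀ (norm_nonneg _) h1 2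

variable [CompleteSpace K]

/-- The unitary `ξ ⊗ h ↦ fockMap ξ h`. -/
def unitary : ((column u).fock.tensor (fockRep n)).Cpl ≃ₗᵢ[ℂ] K :=
  (LinearEquiv.refl ℂ ((column u).fock.tensor (fockRep n)).carrier).extendOfIsometry
    (UniformSpace.Completion.toComplL (𝕜 := ℂ)
      (E := ((column u).fock.tensor (fockRep n)).carrier)).toLinearMap M.tensorMap
    UniformSpace.Completion.denseRange_coe M.denseRange_tensorMap fun x => by
      rw [LinearEquiv.refl_apply, M.norm_tensorMap]
      exact (UniformSpace.Completion.norm_coe x).symm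

theorem unitary_coe (z : ((column u).fock.tensor (fockRep n)).carrier) :
    M.unitary (z : ((column u).fock.tensor (fockRep n)).Cpl) = M.tensorMap z :=
  LinearEquiv.extendOfIsometry_eq (LinearEquiv.refl ℂ _) _ M.tensorMap _ _ _ z

/-- The map `ξ ↦ ξ ⊗ h` into `K`. -/
def embed (h : Fock n) : (column u).fock.Cpl →L[ℂ] K :=
  (M.unitary : ((column u).fock.tensor (fockRep n)).Cpl →L[ℂ] K) ∘L
    tmulRight (column u).fock (fockRep n) h

theorem embed_apply (h : Fock n) (ξ : (column u).fock.Cpl) :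
    M.embed h ξ = M.unitary (tmulRight (column u).fock (fockRep n) h ξ) := rfl

theorem embed_coe (h : Fock n) (ξ : (column u).fock.carrier) :
    M.embed h (ξ : (column u).fock.Cpl) = M.fockMap ξ h := by
  refine (congrArg M.unitary (ContinuousLinearMap.completion_apply_coe _ ξ)).trans ?_
  rw [unitary_coe]
  rfl

end FockModel

/-! ### Actions and creation operators on the completions -/

namespace PreCorr

section
variable {A B C : Type} [CStarAlgebra A] [CStarAlgebra B] [CStarAlgebra C]
  [PartialOrder A] [StarOrderedRing A] [PartialOrder B] [StarOrderedRing B]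
  [PartialOrder C] [StarOrderedRing C]

theorem norm_ract_le (X : PreCorr A B) (b : B) (x : X.carrier) :
    ‖X.ract (.op b) x‖ ≤ ‖b‖ * ‖x‖ := by
  refine abs_le_of_sq_le_sq' ?_ (mul_nonneg (norm_nonneg _) (norm_nonneg _)) |>.2
  rw [mul_pow, X.norm_sq, X.norm_sq, X.ip_ract, X.ip_ract_left]
  calc _ ≤ ‖star b‖ * ‖X.ip x x‖ * ‖b‖ :=
        (norm_mul_le _ _).trans (mul_le_mul_of_nonneg_right (norm_mul_le _ _) (norm_nonneg _))
    _ = _ := by rw [norm_star]; ring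

/-- The right action of `b` on the completion. -/
def rightAction (X : PreCorr A B) (b : B) : X.Cpl →L[ℂ] X.Cpl :=
  ContinuousLinearMap.completion ((X.ract (.op b)).mkContinuous ‖b‖ (X.norm_ract_le b))

theorem rightAction_coe (X : PreCorr A B) (b : B) (x : X.carrier) :
    X.rightAction b (x : X.Cpl) = (X.ract (.op b) x : X.carrier) :=
  ContinuousLinearMap.completion_apply_coe _ x

theorem leftAction_coe (X : PreCorr A B) (a : A) (x : X.carrier) :
    X.leftAction a (x : X.Cpl) = (X.lact a x : X.carrier) :=
  ContinuousLinearMap.completion_apply_coe _ x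

theorem creation_coe (X : PreCorr A A) (x : X.carrier) (ξ : X.fock.carrier) :
    X.creation x (ξ : X.fock.Cpl) = (X.creationAlg x ξ : X.fock.carrier) :=
  ContinuousLinearMap.completion_apply_coe _ ξ

theorem tmulRight_coe (X : PreCorr A B) (Y : PreCorr B C) (y : Y.carrier) (x : X.carrier) :
    tmulRight X Y y (x : X.Cpl) = (tmul X Y x y : (X.tensor Y).carrier) :=
  ContinuousLinearMap.completion_apply_coe _ x

theorem completion_clm_ext {X : PreCorr A B} {V : Type} [NormedAddCommGroup V] [NormedSpace ℂ V]
    {S T : X.Cpl →L[ℂ] V} (h : ∀ x : X.carrier, S (x : X.Cpl) = T (x : X.Cpl)) : S = T :=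
  ContinuousLinearMap.ext fun x => UniformSpace.Completion.induction_on x
    (isClosed_eq S.continuous T.continuous) h

theorem norm_leftAction_le (X : PreCorr A B) (a : A) : ‖X.leftAction a‖ ≤ ‖a‖ :=
  ContinuousLinearMap.opNorm_le_bound _ (norm_nonneg _) fun x =>
    UniformSpace.Completion.induction_on x
      (isClosed_le (by fun_prop) (by fun_prop)) fun x => by
        rw [leftAction_coe, UniformSpace.Completion.norm_coe, UniformSpace.Completion.norm_coe]
        exact X.norm_lact_le a x

/-- The left action on the completion as a homomorphism. -/
def leftActionHom (X : PreCorr A B) : A →ₐ[ℂ] (X.Cpl →L[ℂ] X.Cpl) :=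
  AlgHom.ofLinearMap
    { toFun := X.leftAction
      map_add' := fun a b => completion_clm_ext fun x => by
        rw [add_apply, leftAction_coe, leftAction_coe, leftAction_coe, map_add,
          LinearMap.add_apply, UniformSpace.Completion.coe_add]
      map_smul' := fun c a => completion_clm_ext fun x => by
        rw [RingHom.id_apply, smul_apply, leftAction_coe, leftAction_coe, map_smul,
          LinearMap.smul_apply, UniformSpace.Completion.coe_smul] }
    (completion_clm_ext fun x => by
      change X.leftAction 1 (x : X.Cpl) = _
      rw [leftAction_coe, map_one]; rfl)
    fun a b => completion_clm_ext fun x => by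
      change X.leftAction (a * b) (x : X.Cpl) = X.leftAction a (X.leftAction b (x : X.Cpl))
      rw [leftAction_coe, leftAction_coe, leftAction_coe, map_mul, Module.End.mul_apply]

theorem leftAction_rightAction (X : PreCorr A B) (a : A) (b : B) (ξ : X.Cpl) :
    X.leftAction a (X.rightAction b ξ) = X.rightAction b (X.leftAction a ξ) := by
  have : X.leftAction a ∘L X.rightAction b = X.rightAction b ∘L X.leftAction a :=
    completion_clm_ext fun x => by
      rw [ContinuousLinearMap.comp_apply, ContinuousLinearMap.comp_apply, rightAction_coe,
        leftAction_coe, leftAction_coe, rightAction_coe, lact_ract]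
  exact DFunLike.congr_fun this ξ

theorem creationAlg_ract (X : PreCorr A A) (x : X.carrier) (b : A) (ξ : X.fock.carrier) :
    X.creationAlg x (X.fock.ract (.op b) ξ) = X.fock.ract (.op b) (X.creationAlg x ξ) := by
  induction ξ using fock_induction with
  | zero => simp
  | add ξ ξ' h1 h2 => simp only [map_add, h1, h2]
  | of k ξ =>
    rw [ract_ofPower, creationAlg_ofPower, creationAlg_ofPower]
    exact (ract_ofPower X (k + 1) b (X.prepend x k ξ)).symm

theorem creation_rightAction (X : PreCorr A A) (x : X.carrier) (b : A) (ξ : X.fock.Cpl) :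
    X.creation x (X.fock.rightAction b ξ) = X.fock.rightAction b (X.creation x ξ) := by
  have : X.creation x ∘L X.fock.rightAction b = X.fock.rightAction b ∘L X.creation x :=
    completion_clm_ext fun ξ => by
      rw [ContinuousLinearMap.comp_apply, ContinuousLinearMap.comp_apply, rightAction_coe,
        creation_coe, creation_coe, rightAction_coe, creationAlg_ract]
  exact DFunLike.congr_fun this ξ

theorem leftAction_tmulRight (X : PreCorr A B) (Y : PreCorr B C) (a : A) (y : Y.carrier)
    (ξ : X.Cpl) : (X.tensor Y).leftAction a (tmulRight X Y y ξ) =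
      tmulRight X Y y (X.leftAction a ξ) := by
  have : (X.tensor Y).leftAction a ∘L tmulRight X Y y = tmulRight X Y y ∘L X.leftAction a :=
    completion_clm_ext fun ξ => by
      rw [ContinuousLinearMap.comp_apply, ContinuousLinearMap.comp_apply, tmulRight_coe,
        leftAction_coe, leftAction_coe, tmulRight_coe]
      rfl
  exact DFunLike.congr_fun this ξ

end

end PreCorr

attribute [local irreducible] rightAction leftAction creation tmulRight UniformSpace.Completion.coe'

/-! ### Bounded right module maps and the norms of `ξ ⊗ h` -/

/-- A positive element, perturbed to an invertible one: `p = a + ε` has a square root `s` with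
selfadjoint inverse `b`, and `b a b` is a contraction. -/
theorem exists_inv_sqrt {A : Type} [CStarAlgebra A] [PartialOrder A] [StarOrderedRing A] {a : A}
    (ha : 0 ≤ a) {ε : ℝ} (hε : 0 < ε) : ∃ b s : A, star s = s ∧ b * s = 1 ∧
      s * s = a + algebraMap ℝ A ε ∧ ‖star b * a * b‖ ≤ 1 := by
  set p := a + algebraMap ℝ A ε with hp
  have hε' : IsStrictlyPositive (algebraMap ℝ A ε) := by
    cfc_tac
  have hpos : IsStrictlyPositive p := by
    exact IsStrictlyPositive.nonneg_add ha hε'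
  have hs : star (p ^ (1 / 2 : ℝ)) = p ^ (1 / 2 : ℝ) :=
    (IsSelfAdjoint.of_nonneg CFC.rpow_nonneg).star_eq
  have hb : star (p ^ (-(1 / 2) : ℝ)) = p ^ (-(1 / 2) : ℝ) :=
    (IsSelfAdjoint.of_nonneg CFC.rpow_nonneg).star_eq
  refine ⟨p ^ (-(1 / 2) : ℝ), p ^ (1 / 2 : ℝ), hs, ?_, ?_, ?_⟩
  · rw [← CFC.rpow_add hpos.isUnit, neg_add_cancel, CFC.rpow_zero p hpos.nonneg]
  · rw [← CFC.rpow_add hpos.isUnit]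
    norm_num
    exact CFC.rpow_one p hpos.nonneg
  · have h1 : star (p ^ (-(1 / 2) : ℝ)) * a * p ^ (-(1 / 2) : ℝ) ≤ 1 := by
      -- Here `a ≤ p`, and conjugating `p` by `p^{-1/2}` gives `1`.
      refine (star_left_conjugate_le_conjugate (show a ≤ p from ?_) _).trans ?_
      · rw [hp]; exact le_add_of_nonneg_right hε'.nonneg
      · rw [hb, CFC.conjugate_rpow_neg_one_half p hpos]
    exact (CStarAlgebra.norm_le_one_iff_of_nonneg _ (star_left_conjugate_nonneg ha _)).2 h1

/-- With `a = ⟨ξ, ξ⟩` the right side is `‖ξ ⊗ h‖² + ε ‖h‖²`, so passing from `h` to `s h` costs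
almost nothing more than the norm of `ξ ⊗ h`. -/
theorem norm_sq_of_mul_self_eq {A H : Type} [CStarAlgebra A] [NormedAddCommGroup H]
    [InnerProductSpace ℂ H] [CompleteSpace H] (π : A →⋆ₐ[ℂ] (H →L[ℂ] H)) {s a : A} {ε : ℝ}
    (hs : star s = s) (hss : s * s = a + algebraMap ℝ A ε) (h : H) :
    ‖π s h‖ ^ 2 = (inner ℂ h (π a h)).re + ε * ‖h‖ ^ 2 := by
  have h1 : ‖π s h‖ ^ 2 = (inner ℂ h (π (s * s) h)).re := by
    have hs' : (π s).adjoint = π s := by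
      rw [← ContinuousLinearMap.star_eq_adjoint, ← map_star, hs]
    rw [map_mul, clm_mul_apply, ← ContinuousLinearMap.adjoint_inner_left, hs']
    exact (inner_self_eq_norm_sq (𝕜 := ℂ) _).symm
  have h2 : π (a + algebraMap ℝ A ε) h = π a h + (ε : ℂ) • h := by
    rw [IsScalarTower.algebraMap_apply ℝ ℂ A, map_add, AlgHomClass.commutes]; rfl
  rw [h1, hss, h2, inner_add_right, inner_smul_right, Complex.add_re, Complex.re_ofReal_mul]
  congr 2
  exact inner_self_eq_norm_sq (𝕜 := ℂ) _

theorem norm_rightAction_le_one {A B : Type} [CStarAlgebra A] [PartialOrder A]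
    [StarOrderedRing A] [CStarAlgebra B] [PartialOrder B] [StarOrderedRing B] (X : PreCorr A B)
    {b : B} {ξ : X.carrier} (hb : ‖star b * X.ip ξ ξ * b‖ ≤ 1) :
    ‖X.rightAction b (ξ : X.Cpl)‖ ≤ 1 := by
  rw [rightAction_coe, UniformSpace.Completion.norm_coe]
  refine abs_le_of_sq_le_sq' ?_ zero_le_one |>.2
  rw [PreCorr.norm_sq, PreCorr.ip_ract, PreCorr.ip_ract_left, one_pow]
  exact hb

theorem exists_normalizer {A B : Type} [CStarAlgebra A] [PartialOrder A]
    [StarOrderedRing A] [CStarAlgebra B] [PartialOrder B] [StarOrderedRing B] (X : PreCorr A B)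
    (ξ : X.carrier) {ε : ℝ} (hε : 0 < ε) : ∃ b s : B, star s = s ∧ b * s = 1 ∧
      s * s = X.ip ξ ξ + algebraMap ℝ B ε ∧ ‖X.rightAction b (ξ : X.Cpl)‖ ≤ 1 :=
  let ⟨b, s, hs, hbs, hss, hb⟩ := exists_inv_sqrt (X.ip_self_nonneg ξ) hε
  ⟨b, s, hs, hbs, hss, norm_rightAction_le_one X hb⟩

/-- As `b s = 1` and `T` is a module map, `T ξ ⊗ h = T ξ ⊗ b s h = T (ξ b) ⊗ s h`. Here `ξ b` lies
in the unit ball, so the norm is at most `‖T‖ ‖s h‖`, and `‖s h‖²` is `‖ξ ⊗ h‖² + ε ‖h‖²`. No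
adjoint of `T` is needed. -/
theorem norm_sq_apply_le_of_commute {A H V : Type} [CStarAlgebra A] [PartialOrder A]
    [StarOrderedRing A] [NormedAddCommGroup H] [InnerProductSpace ℂ H] [CompleteSpace H]
    [NormedAddCommGroup V] [NormedSpace ℂ V] (π : A →⋆ₐ[ℂ] (H →L[ℂ] H)) {Z : PreCorr A A}
    {J : H → Z.Cpl →L[ℂ] V} (hJ : ∀ h ξ, ‖J h ξ‖ ≤ ‖h‖ * ‖ξ‖)
    (hJr : ∀ h b ξ, J h (Z.rightAction b ξ) = J (π b h) ξ)
    {T : Z.Cpl →L[ℂ] Z.Cpl} (hT : ∀ b ξ, T (Z.rightAction b ξ) = Z.rightAction b (T ξ))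
    (h : H) {ξ : Z.Cpl} {a b s : A} {ε : ℝ} (hs : star s = s) (hbs : b * s = 1)
    (hss : s * s = a + algebraMap ℝ A ε) (hr : ‖Z.rightAction b ξ‖ ≤ 1)
    (hn : ‖J h ξ‖ ^ 2 = (inner ℂ h (π a h)).re) :
    ‖J h (T ξ)‖ ^ 2 ≤ ‖T‖ ^ 2 * (‖J h ξ‖ ^ 2 + ε * ‖h‖ ^ 2) := by
  have e1 : π b (π s h) = h := by rw [← clm_mul_apply, ← map_mul, hbs, map_one]; rfl
  have e4 : J h (T ξ) = J (π s h) (T (Z.rightAction b ξ)) := by rw [hT, hJr, e1]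
  rw [hn, ← norm_sq_of_mul_self_eq π hs hss h, ← mul_pow, e4]
  refine pow_le_pow_left₀ (norm_nonneg _) ?_ 2
  calc _ ≤ ‖π s h‖ * ‖T (Z.rightAction b ξ)‖ := hJ _ _
    _ ≤ ‖π s h‖ * (‖T‖ * 1) :=
        mul_le_mul_of_nonneg_left ((T.le_opNorm _).trans
          (mul_le_mul_of_nonneg_left hr (norm_nonneg _))) (norm_nonneg _)
    _ = _ := by ring

theorem le_mul_of_forall_pos {x t y z : ℝ} (ht : 0 ≤ t) (hy : 0 ≤ y)
    (h : ∀ ε : ℝ, 0 < ε → x ^ 2 ≤ t ^ 2 * (y ^ 2 + ε * z)) : x ≤ t * y := by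
  refine abs_le_of_sq_le_sq' ?_ (mul_nonneg ht hy) |>.2
  rw [mul_pow]
  have hc : Filter.Tendsto (fun ε : ℝ => t ^ 2 * (y ^ 2 + ε * z))
      (nhdsWithin 0 (Set.Ioi 0)) (nhds (t ^ 2 * (y ^ 2 + 0 * z))) :=
    (Continuous.tendsto (by fun_prop) _).mono_left nhdsWithin_le_nhds
  rw [zero_mul, add_zero] at hc
  exact ge_of_tendsto hc (by filter_upwards [self_mem_nhdsWithin] with ε hε using h ε hε)

/-- A bounded right module map `T` satisfies `⟨T ξ, T ξ⟩ ≤ ‖T‖² ⟨ξ, ξ⟩`. This is stated in terms of the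
maps `J h : ξ ↦ ξ ⊗ h`. -/
theorem norm_apply_le_of_commute {A H V : Type} [CStarAlgebra A] [PartialOrder A]
    [StarOrderedRing A] [NormedAddCommGroup H] [InnerProductSpace ℂ H] [CompleteSpace H]
    [NormedAddCommGroup V] [NormedSpace ℂ V] (π : A →⋆ₐ[ℂ] (H →L[ℂ] H)) {Z : PreCorr A A}
    {J : H → Z.Cpl →L[ℂ] V} (hJ : ∀ h ξ, ‖J h ξ‖ ≤ ‖h‖ * ‖ξ‖)
    (hJr : ∀ h b ξ, J h (Z.rightAction b ξ) = J (π b h) ξ)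
    (hJn : ∀ h (ξ : Z.carrier), ‖J h (ξ : Z.Cpl)‖ ^ 2 = (inner ℂ h (π (Z.ip ξ ξ) h)).re)
    {T : Z.Cpl →L[ℂ] Z.Cpl} (hT : ∀ b ξ, T (Z.rightAction b ξ) = Z.rightAction b (T ξ))
    (h : H) (ξ : Z.Cpl) : ‖J h (T ξ)‖ ≤ ‖T‖ * ‖J h ξ‖ :=
  UniformSpace.Completion.induction_on ξ
    (isClosed_le ((J h ∘L T).continuous.norm)
      (continuous_const.mul (J h).continuous.norm)) fun ξ =>
    le_mul_of_forall_pos (norm_nonneg _) (norm_nonneg _) fun _ hε =>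
      let ⟨_, _, hs, hbs, hss, hr⟩ := exists_normalizer Z ξ hε
      norm_sq_apply_le_of_commute π hJ hJr hT h hs hbs hss hr (hJn h ξ)

/-! ### The operators `T ⊗ I` on a model, their norms, and the representation of `E_n` -/

namespace FockModel

variable {n m : ℕ} {u : Matrix.unitaryGroup (Fin n × Fin m) ℂ} {K : Type}
  [NormedAddCommGroup K] [InnerProductSpace ℂ K] [CompleteSpace K] (M : FockModel u K)

attribute [local irreducible] embed unitary

theorem embed_leftAction_gen (h : Fock n) (i : Fin n) (ξ : (column u).fock.Cpl) :
    M.embed h ((column u).fock.leftAction (gen i) ξ) = M.E i (M.embed h ξ) := by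
  have : M.embed h ∘L (column u).fock.leftAction (gen i) = M.E i ∘L M.embed h :=
    completion_clm_ext fun ξ => by
      change M.embed h ((column u).fock.leftAction (gen i) (ξ : (column u).fock.Cpl)) =
        M.E i (M.embed h (ξ : (column u).fock.Cpl))
      rw [leftAction_coe, embed_coe, embed_coe, fockMap_lact_gen]
  exact DFunLike.congr_fun this ξ

/-- This is `T_x = ∑ T_{δ_j} φ_∞(x_j)`, seen in `K`; it reduces every creation operator to the `F j`
and the left action. -/
theorem embed_creation (h : Fock n) (x : (column u).carrier) (ξ : (column u).fock.Cpl) :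
    M.embed h ((column u).creation x ξ) =
      ∑ j, M.F j (M.embed h ((column u).fock.leftAction (coord u j x) ξ)) := by
  have : M.embed h ∘L (column u).creation x =
      ∑ j, M.F j ∘L M.embed h ∘L (column u).fock.leftAction (coord u j x) :=
    completion_clm_ext fun ξ => by
      simp only [ContinuousLinearMap.comp_apply, sum_apply, creation_coe, leftAction_coe,
        embed_coe, fockMap_creationAlg]
  simpa using DFunLike.congr_fun this ξ

theorem embed_creation_colUnit (h : Fock n) (j : Fin m) (ξ : (column u).fock.Cpl) :
    M.embed h ((column u).creation (colUnit u j) ξ) = M.F j (M.embed h ξ) := by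
  have : M.embed h ∘L (column u).creation (colUnit u j) = M.F j ∘L M.embed h :=
    completion_clm_ext fun ξ => by
      change M.embed h ((column u).creation (colUnit u j) (ξ : (column u).fock.Cpl)) =
        M.F j (M.embed h (ξ : (column u).fock.Cpl))
      rw [creation_coe, embed_coe, embed_coe, fockMap_creationAlg_colUnit]
  exact DFunLike.congr_fun this ξ

theorem embed_rightAction (h : Fock n) (b : toeplitz n) (ξ : (column u).fock.Cpl) :
    M.embed h ((column u).fock.rightAction b ξ) = M.embed (b.1 h) ξ := by
  have : M.embed h ∘L (column u).fock.rightAction b = M.embed (b.1 h) :=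
    completion_clm_ext fun ξ => by
      change M.embed h ((column u).fock.rightAction b (ξ : (column u).fock.Cpl)) =
        M.embed (b.1 h) (ξ : (column u).fock.Cpl)
      rw [rightAction_coe, embed_coe, embed_coe, fockMap_ract]
  exact DFunLike.congr_fun this ξ

theorem norm_embed_le (h : Fock n) (ξ : (column u).fock.Cpl) : ‖M.embed h ξ‖ ≤ ‖h‖ * ‖ξ‖ := by
  refine UniformSpace.Completion.induction_on ξ
    (isClosed_le (by fun_prop) (by fun_prop)) fun ξ => ?_
  rw [embed_coe, UniformSpace.Completion.norm_coe]
  refine abs_le_of_sq_le_sq' ?_ (mul_nonneg (norm_nonneg _) (norm_nonneg _)) |>.2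
  rw [norm_fockMap_sq, mul_pow, PreCorr.norm_sq]
  calc _ ≤ ‖h‖ * ‖((column u).fock.ip ξ ξ).1 h‖ :=
        (Complex.re_le_norm _).trans (norm_inner_le_norm _ _)
    _ ≤ ‖h‖ * (‖((column u).fock.ip ξ ξ).1‖ * ‖h‖) := by
        gcongr; exact ContinuousLinearMap.le_opNorm _ _
    _ = _ := by rw [sq]; change _ = _ * ‖((column u).fock.ip ξ ξ).1‖; ring

/-- As `E_n` acts faithfully on the Fock space, the norm on the Fock correspondence is determined by
the maps `ξ ↦ ξ ⊗ h`. -/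
theorem norm_le_of_embed (ξ : (column u).fock.Cpl) {c : ℝ} (hc : 0 ≤ c)
    (h : ∀ h, ‖M.embed h ξ‖ ≤ c * ‖h‖) : ‖ξ‖ ≤ c := by
  refine le_of_forall_pos_le_add fun ε hε => ?_
  -- For vectors of the algebraic Fock correspondence the bound is `norm_coe_le_of_embed`. An
  -- approximation within `ε / 2` changes the constant `c` by `ε / 2` and the norm by another `ε /
  -- 2`.
  obtain ⟨η, hη⟩ := (UniformSpace.Completion.denseRange_coe
    (α := (column u).fock.carrier)).exists_dist_lt ξ (half_pos hε)
  rw [dist_eq_norm] at hη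
  have h1 : ‖η‖ ≤ c + ε / 2 := M.norm_coe_le_of_embed η (by positivity) fun h' => by
    rw [← M.embed_coe]
    calc ‖M.embed h' (η : (column u).fock.Cpl)‖
        = ‖M.embed h' ξ - M.embed h' (ξ - (η : (column u).fock.Cpl))‖ := by
          rw [map_sub, sub_sub_cancel]
      _ ≤ ‖M.embed h' ξ‖ + ‖M.embed h' (ξ - (η : (column u).fock.Cpl))‖ := norm_sub_le _ _
      _ ≤ c * ‖h'‖ + ‖h'‖ * (ε / 2) := add_le_add (h h')
          ((M.norm_embed_le _ _).trans (mul_le_mul_of_nonneg_left hη.le (norm_nonneg _)))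
      _ = _ := by ring
  calc ‖ξ‖ = ‖(ξ - (η : (column u).fock.Cpl)) + (η : (column u).fock.Cpl)‖ := by
        rw [sub_add_cancel]
    _ ≤ ε / 2 + (c + ε / 2) := (norm_add_le _ _).trans (add_le_add hη.le
        (by rwa [UniformSpace.Completion.norm_coe]))
    _ = c + ε := by ring

theorem norm_embed_apply_le {T : (column u).fock.Cpl →L[ℂ] (column u).fock.Cpl}
    (hT : ∀ b ξ, T ((column u).fock.rightAction b ξ) = (column u).fock.rightAction b (T ξ))
    (h : Fock n) (ξ : (column u).fock.Cpl) : ‖M.embed h (T ξ)‖ ≤ ‖T‖ * ‖M.embed h ξ‖ :=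
  norm_apply_le_of_commute (toeplitz n).subtype M.norm_embed_le M.embed_rightAction (fun h ξ =>
    (congrArg (‖·‖ ^ 2) (M.embed_coe h ξ)).trans (M.norm_fockMap_sq ξ h)) hT h ξ

theorem denseRange_embed_vacuum : DenseRange (M.embed (stdVec [])) := by
  refine M.denseRange_fockMap_vacuum.mono ?_
  rintro _ ⟨ξ, rfl⟩
  exact ⟨ξ, M.embed_coe _ ξ⟩

/-- If the operator `S` is `T ⊗ I`, for a right module map `T`, then its norm is that of `T`. -/
theorem norm_eq_of_embed {T : (column u).fock.Cpl →L[ℂ] (column u).fock.Cpl} {S : K →L[ℂ] K}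
    (hT : ∀ b ξ, T ((column u).fock.rightAction b ξ) = (column u).fock.rightAction b (T ξ))
    (hS : ∀ h ξ, S (M.embed h ξ) = M.embed h (T ξ)) : ‖S‖ = ‖T‖ := by
  refine le_antisymm ?_ ?_
  · refine ContinuousLinearMap.opNorm_le_bound _ (norm_nonneg _) fun x => ?_
    -- The vectors `ξ ⊗ Ω` are dense, so a single `h` suffices and no sums of elementary tensors
    -- have to be estimated.
    refine M.denseRange_embed_vacuum.induction_on x
      (isClosed_le (by fun_prop) (by fun_prop)) fun ξ => ?_
    rw [hS]
    exact M.norm_embed_apply_le hT _ _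
  · refine ContinuousLinearMap.opNorm_le_bound _ (norm_nonneg _) fun ξ => ?_
    -- For this inequality all `h` are needed, since the vacuum alone does not determine the norm of
    -- `T ξ`.
    refine M.norm_le_of_embed _ (mul_nonneg (norm_nonneg _) (norm_nonneg _)) fun h => ?_
    rw [← hS]
    calc _ ≤ ‖S‖ * (‖h‖ * ‖ξ‖) := (S.le_opNorm _).trans
          (mul_le_mul_of_nonneg_left (M.norm_embed_le _ _) (norm_nonneg _))
      _ = _ := by ring

/-- The representation `a ↦ a ⊗ I` of `E_n` on `K`. -/
def rep : toeplitz n →ₐ[ℂ] (K →L[ℂ] K) :=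
  (M.unitary.toContinuousLinearEquiv.conjContinuousAlgEquiv.toAlgEquiv.toAlgHom).comp
    ((column u).fock.tensor (fockRep n)).leftActionHom

theorem rep_unitary (a : toeplitz n) (z : ((column u).fock.tensor (fockRep n)).Cpl) :
    M.rep a (M.unitary z) =
      M.unitary (((column u).fock.tensor (fockRep n)).leftAction a z) :=
  congrArg (fun z => M.unitary (((column u).fock.tensor (fockRep n)).leftAction a z))
    (M.unitary.symm_apply_apply z)

attribute [local irreducible] rep

theorem rep_embed (a : toeplitz n) (h : Fock n) (ξ : (column u).fock.Cpl) :
    M.rep a (M.embed h ξ) = M.embed h ((column u).fock.leftAction a ξ) :=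
  (congrArg (M.rep a) (M.embed_apply h ξ)).trans ((M.rep_unitary a _).trans
    ((congrArg M.unitary (leftAction_tmulRight _ _ a _ ξ)).trans (M.embed_apply h _).symm))

theorem norm_rep_le (a : toeplitz n) : ‖M.rep a‖ ≤ ‖a‖ :=
  ContinuousLinearMap.opNorm_le_bound _ (norm_nonneg _) fun x => by
    obtain ⟨z, rfl⟩ := M.unitary.surjective x
    calc ‖M.rep a (M.unitary z)‖ = ‖((column u).fock.tensor (fockRep n)).leftAction a z‖ :=
          (congrArg norm (M.rep_unitary a z)).trans (M.unitary.norm_map _)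
      _ ≤ ‖a‖ * ‖z‖ := ContinuousLinearMap.le_of_opNorm_le _ (PreCorr.norm_leftAction_le _ a) z
      _ = ‖a‖ * ‖M.unitary z‖ := congrArg _ (M.unitary.norm_map z).symm

theorem rep_gen (i : Fin n) : M.rep (gen i) = M.E i := by
  refine ContinuousLinearMap.ext fun x => ?_
  refine M.denseRange_embed_vacuum.induction_on x
    (isClosed_eq (by fun_prop) (by fun_prop)) fun ξ => ?_
  rw [rep_embed, embed_leftAction_gen]

theorem rep_tensorMap (a : toeplitz n) (z : ((column u).fock.tensor (fockRep n)).carrier) :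
    M.rep a (M.tensorMap z) = M.tensorMap (((column u).fock.tensor (fockRep n)).lact a z) :=
  (congrArg (M.rep a) (M.unitary_coe z).symm).trans ((M.rep_unitary a _).trans
    ((congrArg M.unitary (leftAction_coe _ a z)).trans (M.unitary_coe _)))

/-- The left action on a correspondence is by adjointable operators, with adjoints given by the
involution of the algebra, and `tensorMap` preserves inner products and has dense range. -/
theorem inner_rep (a : toeplitz n) (x y : K) :
    inner ℂ (M.rep a x) y = inner ℂ x (M.rep (star a) y) := by
  refine M.denseRange_tensorMap.induction_on x
    (isClosed_eq ((M.rep a).continuous.inner continuous_const)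
      (continuous_id.inner continuous_const)) fun z => ?_
  refine M.denseRange_tensorMap.induction_on y
    (isClosed_eq (continuous_const.inner continuous_id)
      (continuous_const.inner (M.rep (star a)).continuous)) fun w => ?_
  exact (congrArg (inner ℂ · (M.tensorMap w)) (M.rep_tensorMap a z)).trans
    ((M.inner_tensorMap _ w).trans ((PreCorr.ip_lact _ a z w).trans
      ((M.inner_tensorMap z _).symm.trans
        (congrArg (inner ℂ (M.tensorMap z)) (M.rep_tensorMap (star a) w).symm))))

theorem rep_star_gen (i : Fin n) : M.rep (star (gen i)) = star (M.E i) := by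
  rw [ContinuousLinearMap.star_eq_adjoint, ContinuousLinearMap.eq_adjoint_iff]
  intro x y
  rw [inner_rep, star_star, rep_gen]

end FockModel

/-! ### Isometric isomorphisms from intertwined generators -/

section Transfer

variable {ι E K : Type} [NormedAddCommGroup E] [NormedSpace ℂ E]
  [NormedAddCommGroup K] [NormedSpace ℂ K]

/-- The pairs `(T, S)` in `𝓑 × 𝓒` for which the family `J` intertwines `T` and `S`. -/
def intertwined (J : ι → E →L[ℂ] K) (𝓑 : Subalgebra ℂ (E →L[ℂ] E)) (𝓒 : Subalgebra ℂ (K →L[ℂ] K)) :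
    Subalgebra ℂ ((E →L[ℂ] E) × (K →L[ℂ] K)) where
  carrier := {p | p.1 ∈ 𝓑 ∧ p.2 ∈ 𝓒 ∧ ∀ h ξ, p.2 (J h ξ) = J h (p.1 ξ)}
  mul_mem' := by
    rintro p q ⟨h1, h2, h3⟩ ⟨h1', h2', h3'⟩
    refine ⟨mul_mem h1 h1', mul_mem h2 h2', fun h ξ => ?_⟩
    rw [Prod.fst_mul, Prod.snd_mul, clm_mul_apply, clm_mul_apply, h3', h3]
  add_mem' := by
    rintro p q ⟨h1, h2, h3⟩ ⟨h1', h2', h3'⟩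
    refine ⟨add_mem h1 h1', add_mem h2 h2', fun h ξ => ?_⟩
    rw [Prod.fst_add, Prod.snd_add, add_apply, add_apply, h3', h3, map_add]
  algebraMap_mem' c := by
    refine ⟨algebraMap_mem _ c, algebraMap_mem _ c, fun h ξ => ?_⟩
    exact ((J h).map_smul c ξ).symm

theorem mem_intertwined {J : ι → E →L[ℂ] K} {𝓑 : Subalgebra ℂ (E →L[ℂ] E)}
    {𝓒 : Subalgebra ℂ (K →L[ℂ] K)} {p : (E →L[ℂ] E) × (K →L[ℂ] K)} :
    p ∈ intertwined J 𝓑 𝓒 ↔ p.1 ∈ 𝓑 ∧ p.2 ∈ 𝓒 ∧ ∀ h ξ, p.2 (J h ξ) = J h (p.1 ξ) := Iff.rfl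

theorem isClosed_intertwined (J : ι → E →L[ℂ] K) {𝓑 : Subalgebra ℂ (E →L[ℂ] E)}
    {𝓒 : Subalgebra ℂ (K →L[ℂ] K)} (hB : IsClosed (𝓑 : Set (E →L[ℂ] E)))
    (hC : IsClosed (𝓒 : Set (K →L[ℂ] K))) :
    IsClosed (intertwined J 𝓑 𝓒 : Set ((E →L[ℂ] E) × (K →L[ℂ] K))) := by
  have e : (intertwined J 𝓑 𝓒 : Set ((E →L[ℂ] E) × (K →L[ℂ] K))) = Prod.fst ⁻¹' 𝓑 ∩
      (Prod.snd ⁻¹' 𝓒 ∩ ⋂ h, ⋂ ξ,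
        {p : (E →L[ℂ] E) × (K →L[ℂ] K) | p.2 (J h ξ) = J h (p.1 ξ)}) := by
    ext p
    simp [mem_intertwined]
  rw [e]
  exact (hB.preimage continuous_fst).inter ((hC.preimage continuous_snd).inter
    (isClosed_iInter fun h => isClosed_iInter fun ξ => isClosed_eq (by fun_prop) (by fun_prop)))

/-- If intertwined operators have the same norm, and generators on either side are intertwined with
members of the algebra on the other side, then the two closed algebras are isometrically
isomorphic. -/
theorem exists_algEquiv_of_intertwined [CompleteSpace E] [CompleteSpace K] (J : ι → E →L[ℂ] K)
    (𝓜 : Subalgebra ℂ (E →L[ℂ] E))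
    (h𝓜 : IsClosed (𝓜 : Set (E →L[ℂ] E)))
    (hnorm : ∀ T ∈ 𝓜, ∀ S : K →L[ℂ] K, (∀ h ξ, S (J h ξ) = J h (T ξ)) → ‖S‖ = ‖T‖)
    {s : Set (E →L[ℂ] E)} {t : Set (K →L[ℂ] K)} (hs : s ⊆ 𝓜)
    (h1 : ∀ T ∈ s, ∃ S ∈ (Algebra.adjoin ℂ t).topologicalClosure,
      ∀ h ξ, S (J h ξ) = J h (T ξ))
    (h2 : ∀ S ∈ t, ∃ T ∈ (Algebra.adjoin ℂ s).topologicalClosure,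
      ∀ h ξ, S (J h ξ) = J h (T ξ)) :
    ∃ Φ : (Algebra.adjoin ℂ s).topologicalClosure ≃ₐ[ℂ] (Algebra.adjoin ℂ t).topologicalClosure,
      Isometry Φ ∧ ∀ T h ξ, (Φ T : K →L[ℂ] K) (J h ξ) = J h ((T : E →L[ℂ] E) ξ) := by
  set 𝓑 := (Algebra.adjoin ℂ s).topologicalClosure with h𝓑
  set 𝓒 := (Algebra.adjoin ℂ t).topologicalClosure with h𝓒
  have hBM : 𝓑 ≤ 𝓜 := Subalgebra.topologicalClosure_minimal (Algebra.adjoin_le hs) h𝓜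
  have hs𝓑 : s ⊆ 𝓑 := Algebra.subset_adjoin.trans (Subalgebra.le_topologicalClosure _)
  have ht𝓒 : t ⊆ 𝓒 := Algebra.subset_adjoin.trans (Subalgebra.le_topologicalClosure _)
  have hΓ := isClosed_intertwined J (𝓑 := 𝓑) (𝓒 := 𝓒) (Subalgebra.isClosed_topologicalClosure _)
    (Subalgebra.isClosed_topologicalClosure _)
  set Γ := intertwined J 𝓑 𝓒
  have : CompleteSpace Γ := hΓ.completeSpace_coe
  -- The norm identity holds on all of `𝓑`, and not only on the generators, because `𝓜` is a closed
  -- algebra that contains them.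
  have hn : ∀ p ∈ Γ, ‖p.2‖ = ‖p.1‖ := fun p hp => hnorm _ (hBM hp.1) _ hp.2.2
  let f : Γ →ₐ[ℂ] (E →L[ℂ] E) := (AlgHom.fst ℂ _ _).comp Γ.val
  let g : Γ →ₐ[ℂ] (K →L[ℂ] K) := (AlgHom.snd ℂ _ _).comp Γ.val
  -- The product carries the maximum norm, so equality of the two norms makes either projection
  -- isometric.
  have hf : Isometry f := AddMonoidHomClass.isometry_of_norm f fun p => by
    change ‖p.1.1‖ = max ‖p.1.1‖ ‖p.1.2‖
    rw [hn p.1 p.2, max_self]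
  have hg : Isometry g := AddMonoidHomClass.isometry_of_norm g fun p => by
    change ‖p.1.2‖ = max ‖p.1.1‖ ‖p.1.2‖
    rw [hn p.1 p.2, max_self]
  -- The range of an isometry on the complete algebra `Γ` is closed, so it contains `𝓑` once it
  -- contains the generators.
  have hfr : 𝓑 ≤ f.range := by
    refine Subalgebra.topologicalClosure_minimal (Algebra.adjoin_le fun T hT => ?_)
      hf.isClosedEmbedding.isClosed_range
    obtain ⟨S, hS, h⟩ := h1 T hT
    exact ⟨⟨(T, S), hs𝓑 hT, hS, h⟩, rfl⟩
  have hgr : 𝓒 ≤ g.range := by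
    refine Subalgebra.topologicalClosure_minimal (Algebra.adjoin_le fun S hS => ?_)
      hg.isClosedEmbedding.isClosed_range
    obtain ⟨T, hT, h⟩ := h2 S hS
    exact ⟨⟨(T, S), hT, ht𝓒 hS, h⟩, rfl⟩
  -- Both projections are bijective, so `Γ` is the graph of the isomorphism.
  let f' : Γ ≃ₐ[ℂ] 𝓑 := AlgEquiv.ofBijective (f.codRestrict 𝓑 fun p => p.2.1)
    ⟨fun p q h => hf.injective (congrArg Subtype.val h), fun T => by
      obtain ⟨p, hp⟩ := hfr T.2
      exact ⟨p, Subtype.ext hp⟩⟩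
  let g' : Γ ≃ₐ[ℂ] 𝓒 := AlgEquiv.ofBijective (g.codRestrict 𝓒 fun p => p.2.2.1)
    ⟨fun p q h => hg.injective (congrArg Subtype.val h), fun S => by
      obtain ⟨p, hp⟩ := hgr S.2
      exact ⟨p, Subtype.ext hp⟩⟩
  refine ⟨f'.symm.trans g', AddMonoidHomClass.isometry_of_norm _ fun T => ?_, fun T h ξ => ?_⟩
  · obtain ⟨p, rfl⟩ := f'.surjective T
    rw [AlgEquiv.trans_apply, AlgEquiv.symm_apply_apply]
    exact hn p.1 p.2
  · obtain ⟨p, rfl⟩ := f'.surjective T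
    rw [AlgEquiv.trans_apply, AlgEquiv.symm_apply_apply]
    exact p.2.2.2 h ξ

end Transfer

/-! ### The closed algebra of bounded module maps, and generation of `E_n` -/

namespace PreCorr

variable {A B : Type} [CStarAlgebra A] [CStarAlgebra B]
  [PartialOrder A] [StarOrderedRing A] [PartialOrder B] [StarOrderedRing B]

/-- The bounded right module maps. -/
def moduleMaps (X : PreCorr A B) : Subalgebra ℂ (X.Cpl →L[ℂ] X.Cpl) :=
  Subalgebra.centralizer ℂ (Set.range X.rightAction)

theorem mem_moduleMaps {X : PreCorr A B} {T : X.Cpl →L[ℂ] X.Cpl} :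
    T ∈ X.moduleMaps ↔ ∀ b ξ, T (X.rightAction b ξ) = X.rightAction b (T ξ) := by
  rw [moduleMaps, Subalgebra.mem_centralizer_iff, Set.forall_mem_range]
  refine forall_congr' fun b => ?_
  rw [eq_comm, ContinuousLinearMap.ext_iff]
  rfl

theorem isClosed_moduleMaps (X : PreCorr A B) :
    IsClosed (X.moduleMaps : Set (X.Cpl →L[ℂ] X.Cpl)) :=
  Set.isClosed_centralizer _

theorem leftAction_mem_moduleMaps (X : PreCorr A B) (a : A) : X.leftAction a ∈ X.moduleMaps :=
  mem_moduleMaps.2 fun b ξ => X.leftAction_rightAction a b ξ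

theorem creation_mem_moduleMaps (X : PreCorr A A) (x : X.carrier) :
    X.creation x ∈ X.fock.moduleMaps :=
  mem_moduleMaps.2 fun b ξ => X.creation_rightAction x b ξ

end PreCorr

/-- As a closed algebra, without use of the involution, `E_n` is generated by the `L_i` together
with their adjoints. This form suits `rep`, whose target algebra is not assumed to be closed under
adjoints. -/
theorem mem_of_gen_mem {n : ℕ} {B : Subalgebra ℂ (toeplitz n)}
    (hB : IsClosed (B : Set (toeplitz n))) (h : ∀ i, gen i ∈ B) (hs : ∀ i, star (gen i) ∈ B)
    (a : toeplitz n) : a ∈ B := by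
  have h1 : Algebra.adjoin ℂ (Set.range (shift (n := n)) ∪ star (Set.range (shift (n := n)))) ≤
      B.map (toeplitz n).subtype.toAlgHom := by
    refine Algebra.adjoin_le ?_
    rintro x (⟨i, rfl⟩ | ⟨i, hi⟩)
    · exact ⟨gen i, h i, rfl⟩
    · exact ⟨star (gen i), hs i, by rw [← star_star x, ← hi]; rfl⟩
  -- Since `E_n` is closed among all operators, a closed subset of it remains closed there, which
  -- lets the closure in the definition of `E_n` be absorbed.
  have hcl : IsClosed ((B.map (toeplitz n).subtype.toAlgHom : Subalgebra ℂ _) :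
      Set (Fock n →L[ℂ] Fock n)) :=
    (IsClosed.isClosedEmbedding_subtypeVal (s := (toeplitz n : Set (Fock n →L[ℂ] Fock n)))
      isClosed_closure).isClosedMap _ hB
  have h2 : (a : Fock n →L[ℂ] Fock n) ∈ closure
      (StarAlgebra.adjoin ℂ (Set.range (shift (n := n))) : Set (Fock n →L[ℂ] Fock n)) := a.2
  obtain ⟨b, hb, hba⟩ := closure_minimal (fun x hx => h1 hx) hcl h2
  rwa [← show b = a from Subtype.ext hba]

/-! ### Identification of the algebras generated on a model -/

namespace FockModel

variable {n m : ℕ} {u : Matrix.unitaryGroup (Fin n × Fin m) ℂ} {K : Type}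
  [NormedAddCommGroup K] [InnerProductSpace ℂ K] [CompleteSpace K] (M : FockModel u K)

theorem implements_adjoin {s : Set ((column u).fock.Cpl →L[ℂ] (column u).fock.Cpl)}
    {t : Set (K →L[ℂ] K)} (hs : s ⊆ (column u).fock.moduleMaps)
    (h1 : ∀ T ∈ s, ∃ S ∈ (Algebra.adjoin ℂ t).topologicalClosure,
      ∀ h ξ, S (M.embed h ξ) = M.embed h (T ξ))
    (h2 : ∀ S ∈ t, ∃ T ∈ (Algebra.adjoin ℂ s).topologicalClosure,
      ∀ h ξ, S (M.embed h ξ) = M.embed h (T ξ)) :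
    Implements M.unitary (Algebra.adjoin ℂ s).topologicalClosure
      (Algebra.adjoin ℂ t).topologicalClosure :=
  exists_algEquiv_of_intertwined M.embed (column u).fock.moduleMaps
    (PreCorr.isClosed_moduleMaps _) (fun _ hT _ hS => M.norm_eq_of_embed (mem_moduleMaps.1 hT) hS)
    hs h1 h2

/-- The closed algebra generated by the `E i`, their adjoints and the `F j`. -/
def algStar : Subalgebra ℂ (K →L[ℂ] K) :=
  (Algebra.adjoin ℂ (Set.range M.E ∪ Set.range (fun i => star (M.E i)) ∪
    Set.range M.F)).topologicalClosure

theorem subset_algStar : Set.range M.E ∪ Set.range (fun i => star (M.E i)) ∪ Set.range M.F ⊆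
    (M.algStar : Set (K →L[ℂ] K)) :=
  Algebra.subset_adjoin.trans (Subalgebra.le_topologicalClosure _)

/-- The preimage of `algStar` under `rep` is a closed subalgebra of `E_n`, because `rep` is
contractive, and it contains the generators and their adjoints. -/
theorem rep_mem (a : toeplitz n) : M.rep a ∈ M.algStar := by
  have hcont : Continuous M.rep :=
    AddMonoidHomClass.continuous_of_bound M.rep 1 fun a => by
      rw [one_mul]; exact M.norm_rep_le a
  refine mem_of_gen_mem (B := M.algStar.comap M.rep)
    ((Subalgebra.isClosed_topologicalClosure _).preimage hcont) (fun i => ?_) (fun i => ?_) a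
  · exact M.subset_algStar (.inl (.inl ⟨i, (M.rep_gen i).symm⟩))
  · exact M.subset_algStar (.inl (.inr ⟨i, (M.rep_star_gen i).symm⟩))

theorem implements_analyticSub : Implements M.unitary (analyticSub u)
    (Algebra.adjoin ℂ (Set.range M.E ∪ Set.range M.F)).topologicalClosure := by
  refine M.implements_adjoin ?_ ?_ ?_
  · rintro _ (⟨i, rfl⟩ | ⟨j, rfl⟩)
    · exact PreCorr.leftAction_mem_moduleMaps _ _
    · exact PreCorr.creation_mem_moduleMaps _ _
  · rintro _ (⟨i, rfl⟩ | ⟨j, rfl⟩)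
    · exact ⟨M.E i, Subalgebra.le_topologicalClosure _ (Algebra.subset_adjoin (.inl ⟨i, rfl⟩)),
        fun h ξ => (M.embed_leftAction_gen h i ξ).symm⟩
    · exact ⟨M.F j, Subalgebra.le_topologicalClosure _ (Algebra.subset_adjoin (.inr ⟨j, rfl⟩)),
        fun h ξ => (M.embed_creation_colUnit h j ξ).symm⟩
  · rintro _ (⟨i, rfl⟩ | ⟨j, rfl⟩)
    · exact ⟨_, Subalgebra.le_topologicalClosure _ (Algebra.subset_adjoin (.inl ⟨i, rfl⟩)),
        fun h ξ => (M.embed_leftAction_gen h i ξ).symm⟩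
    · exact ⟨_, Subalgebra.le_topologicalClosure _ (Algebra.subset_adjoin (.inr ⟨j, rfl⟩)),
        fun h ξ => (M.embed_creation_colUnit h j ξ).symm⟩

/-- The adjoints of the `E i` arise because `φ_∞` is applied to all of `E_n`, including the `L_i⋆`.
Adjoints of the `F j` do not arise, as only creation operators are adjoined. -/
theorem implements_tensorAlgebra :
    Implements M.unitary (column u).tensorAlgebra M.algStar := by
  refine M.implements_adjoin ?_ ?_ ?_
  · rintro _ (⟨a, rfl⟩ | ⟨x, rfl⟩)
    · exact PreCorr.leftAction_mem_moduleMaps _ _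
    · exact PreCorr.creation_mem_moduleMaps _ _
  · rintro _ (⟨a, rfl⟩ | ⟨x, rfl⟩)
    · exact ⟨M.rep a, M.rep_mem a, fun h ξ => M.rep_embed a h ξ⟩
    -- The partner of `T_x` comes from `T_x = ∑ T_{δ_j} φ_∞(x_j)`.
    · refine ⟨∑ j, M.F j * M.rep (coord u j x), sum_mem fun j _ =>
        mul_mem (M.subset_algStar (.inr ⟨j, rfl⟩)) (M.rep_mem _), fun h ξ => ?_⟩
      refine Eq.trans ?_ (M.embed_creation h x ξ).symm
      rw [sum_apply]
      exact Finset.sum_congr rfl fun j _ => congrArg (M.F j) (M.rep_embed _ h ξ)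
  · rintro _ ((⟨i, rfl⟩ | ⟨i, rfl⟩) | ⟨j, rfl⟩)
    · exact ⟨_, Subalgebra.le_topologicalClosure _ (Algebra.subset_adjoin (.inl ⟨gen i, rfl⟩)),
        fun h ξ => (M.embed_leftAction_gen h i ξ).symm⟩
    · exact ⟨_, Subalgebra.le_topologicalClosure _
        (Algebra.subset_adjoin (.inl ⟨star (gen i), rfl⟩)),
        fun h ξ => (congrArg (fun S : K →L[ℂ] K => S (M.embed h ξ)) (M.rep_star_gen i)).symm.trans
          (M.rep_embed _ h ξ)⟩
    · exact ⟨_, Subalgebra.le_topologicalClosure _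
        (Algebra.subset_adjoin (.inr ⟨colUnit u j, rfl⟩)),
        fun h ξ => (M.embed_creation_colUnit h j ξ).symm⟩

end FockModel

theorem analyticSub_le {n m : ℕ} (u : Matrix.unitaryGroup (Fin n × Fin m) ℂ) :
    analyticSub u ≤ (column u).tensorAlgebra := by
  refine Subalgebra.topologicalClosure_mono (Algebra.adjoin_mono (Set.union_subset_union ?_ ?_))
  · rintro _ ⟨i, rfl⟩
    exact ⟨gen i, rfl⟩
  · rintro _ ⟨j, rfl⟩
    exact ⟨colUnit u j, rfl⟩

theorem dense_of_stdVec_mem {ι : Type} (M : Submodule ℂ (L2 ι)) (h : ∀ i, stdVec i ∈ M) :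
    Dense (M : Set (L2 ι)) := by
  classical
  intro x
  have hx := lp.hasSum_single (E := fun _ : ι => ℂ) (p := 2) (by simp) x
  refine mem_closure_of_tendsto hx (Filter.Eventually.of_forall fun s => ?_)
  refine M.sum_mem fun i _ => ?_
  have e : lp.single (E := fun _ : ι => ℂ) 2 i (x i) = x i • stdVec i := by
    rw [stdVec, ← lp.single_smul]
    simp only [smul_eq_mul, mul_one]
  rw [e]
  exact M.smul_mem _ (h i)

/-! ### The Fock space of `(E, F, u)` as a model in two ways -/

section
variable {n m : ℕ} (u : Matrix.unitaryGroup (Fin n × Fin m) ℂ)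

/-- Every basis vector is obtained from the vacuum by applying the shifts by the letters of `v` and
after that those by the letters of `w`. In this order each `L_{f_j}` meets an empty word in `E`, so
no exchange of letters takes place. -/
theorem dense_of_shift_invariant (M : Submodule ℂ (Fock₂ n m)) (h0 : stdVec ([], []) ∈ M)
    (hE : ∀ i, ∀ x ∈ M, shiftE m i x ∈ M) (hF : ∀ j, ∀ x ∈ M, shiftF u j x ∈ M) :
    Dense (M : Set (Fock₂ n m)) := by
  refine dense_of_stdVec_mem M ?_
  rintro ⟨w, v⟩
  induction w with
  | nil =>
    induction v with
    | nil => exact h0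
    | cons j v ih =>
      have := hF j _ ih
      rwa [shiftF_stdVec] at this
  | cons i w ih =>
    have := hE i _ ih
    rwa [shiftE_stdVec] at this

theorem inner_shiftF (j l : Fin m) (x y : Fock₂ n m) :
    inner ℂ (shiftF u j x) (shiftF u l y) = if j = l then inner ℂ x y else (0 : ℂ) := by
  split_ifs with h
  · subst h; exact inner_isom _ _ x y
  · have : (shiftF u j).adjoint ∘L shiftF u l = 0 := clm_ext fun p => vec_ext fun q => by
      classical
      rw [ContinuousLinearMap.comp_apply, ContinuousLinearMap.adjoint_inner_right,
        ← Prod.mk.eta (p := p), ← Prod.mk.eta (p := q), shiftF_stdVec, shiftF_stdVec, inner_frontF]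
      simp [h]
    rw [← ContinuousLinearMap.adjoint_inner_right, ← ContinuousLinearMap.comp_apply, this]
    simp

/-- Exchanging letters keeps their number, so every term of `f_l ⊗ e_w ⊗ f_v` retains at least one
letter from `F`. -/
theorem adjoint_rightTensor_nil_frontF (w : List (Fin n)) (v : List (Fin m)) (l : Fin m) :
    (rightTensor []).adjoint (frontF u w v l) = 0 := by
  induction w generalizing l with
  | nil => rw [frontF, adjoint_rightTensor_stdVec, if_neg (by simp)]
  | cons k w ih => simp [frontF, adjoint_rightTensor_shiftE, ih]

theorem inner_rightTensor_nil_shiftF (l : Fin m) (x : Fock n) (y : Fock₂ n m) :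
    inner ℂ (rightTensor [] x) (shiftF u l y) = (0 : ℂ) := by
  have : (rightTensor []).adjoint ∘L shiftF u l = 0 := clm_ext fun p => by
    rw [ContinuousLinearMap.comp_apply, ← Prod.mk.eta (p := p), shiftF_stdVec,
      adjoint_rightTensor_nil_frontF]
    rfl
  rw [← ContinuousLinearMap.adjoint_inner_right, ← ContinuousLinearMap.comp_apply, this]
  simp

/-- On basis vectors this is the recursion that defines `frontF`. -/
theorem shiftF_shiftE (l : Fin m) (k : Fin n) (x : Fock₂ n m) :
    shiftF u l (shiftE m k x) =
      ∑ i, ∑ j, star (u.1 (i, j) (k, l)) • shiftE m i (shiftF u j x) := by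
  have : shiftF u l ∘L shiftE m k =
      ∑ i, ∑ j, star (u.1 (i, j) (k, l)) • (shiftE m i ∘L shiftF u j) := clm_ext fun p => by
    obtain ⟨w, v⟩ := p
    simp [sum_apply, shiftE_stdVec, shiftF_stdVec, frontF]
  have h := DFunLike.congr_fun this x
  simpa [sum_apply] using h

/-- The relation `shiftF_shiftE` is inverted by the orthonormality of the rows of `u`: after
substitution only the term with `(i', j') = (i, j)` survives. -/
theorem shiftE_shiftF (i : Fin n) (j : Fin m) (x : Fock₂ n m) :
    shiftE m i (shiftF u j x) =
      ∑ l, ∑ k, u.1 (i, j) (k, l) • shiftF u l (shiftE m k x) := by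
  simp only [shiftF_shiftE, Finset.smul_sum, smul_smul]
  have h : ∀ i' j', (∑ l : Fin m, ∑ k : Fin n, (u.1 (i, j) (k, l) * star (u.1 (i', j') (k, l))) •
      shiftE m i' (shiftF u j' x)) =
      if (i, j) = (i', j') then shiftE m i' (shiftF u j' x) else 0 := fun i' j' => by
    rw [Finset.sum_comm]
    simp only [← Finset.sum_smul, unitary_row, ite_smul, one_smul, zero_smul]
  have e : (∑ l : Fin m, ∑ k : Fin n, ∑ i' : Fin n, ∑ j' : Fin m,
      (u.1 (i, j) (k, l) * star (u.1 (i', j') (k, l))) • shiftE m i' (shiftF u j' x)) =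
      ∑ i' : Fin n, ∑ j' : Fin m, ∑ l : Fin m, ∑ k : Fin n,
      (u.1 (i, j) (k, l) * star (u.1 (i', j') (k, l))) • shiftE m i' (shiftF u j' x) := by
    simp only [← Fintype.sum_prod_type' (f := fun (l : Fin m) (k : Fin n) => _),
      ← Fintype.sum_prod_type' (f := fun (i' : Fin n) (j' : Fin m) => _)]
    exact Finset.sum_comm
  rw [e]
  simp only [h]
  rw [Finset.sum_eq_single i (fun a _ ha => by simp [Ne.symm ha]) (by simp),
    Finset.sum_eq_single j (fun b _ hb => by simp [Ne.symm hb]) (by simp), if_pos rfl]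

/-- The shifts on the Fock space of `(E, F, u)`, with the Fock space of `E` as the vacuum part. -/
def modelE : FockModel u (Fock₂ n m) where
  E := shiftE m
  F := shiftF u
  vac := rightTensor []
  inner_F := inner_shiftF u
  inner_vac := inner_isom _ _
  inner_vac_F := inner_rightTensor_nil_shiftF u
  vac_shift i x := by
    have : rightTensor (m := m) [] ∘L shift i = shiftE m i ∘L rightTensor [] := clm_ext fun w => by
      simp [rightTensor_stdVec, shiftE_stdVec, shift_stdVec]
    exact DFunLike.congr_fun this x
  E_F := shiftE_shiftF u
  dense_of_invariant M h0 hE hF := by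
    rw [rightTensor_stdVec] at h0
    exact dense_of_shift_invariant u M h0 hE hF

/-- The isometry `h ↦ e_∅ ⊗ h`. -/
def leftTensorNil (n m : ℕ) : Fock m →L[ℂ] Fock₂ n m :=
  isom (fun v => stdVec ([], v)) (orthonormal_stdVec fun _ _ h => (Prod.mk.inj h).2)

theorem leftTensorNil_stdVec (v : List (Fin m)) :
    leftTensorNil n m (stdVec v) = stdVec ([], v) := isom_stdVec _ _ _

/-- The shifts on the Fock space of `(E, F, u)`, with the Fock space of `F` as the vacuum part. -/
def modelF : FockModel (swapU u) (Fock₂ n m) where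
  E := shiftF u
  F := shiftE m
  vac := leftTensorNil n m
  inner_F := inner_shiftE
  inner_vac := inner_isom _ _
  inner_vac_F i x y := by
    have : (shiftE m i).adjoint ∘L leftTensorNil n m = 0 := clm_ext fun v => vec_ext fun q => by
      rw [ContinuousLinearMap.comp_apply, ContinuousLinearMap.adjoint_inner_right,
        leftTensorNil_stdVec, ← inner_conj_symm, inner_shiftE_nil]
      simp
    rw [← ContinuousLinearMap.adjoint_inner_left, ← ContinuousLinearMap.comp_apply, this]
    simp
  vac_shift l x := by
    have : leftTensorNil n m ∘L shift l = shiftF u l ∘L leftTensorNil n m := clm_ext fun v => by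
      simp [leftTensorNil_stdVec, shiftF_stdVec, shift_stdVec, frontF]
    exact DFunLike.congr_fun this x
  -- The entries of `swapU u` are the conjugates that appear in `shiftF_shiftE`, with both pairs of
  -- indices transposed. In this direction the relation needs no inversion of `u`.
  E_F l i x := shiftF_shiftE u l i x
  dense_of_invariant M h0 hF hE := by
    rw [leftTensorNil_stdVec] at h0
    exact dense_of_shift_invariant u M h0 hE hF

theorem algStar_modelF : (modelF u).algStar = algF u := by
  change (Algebra.adjoin ℂ (Set.range (shiftF u) ∪ Set.range (fun j => star (shiftF u j)) ∪
    Set.range (shiftE m))).topologicalClosure = _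
  rw [algF, Set.union_comm, Set.union_comm (Set.range (shiftF u)), Set.union_assoc]

end

end URA

end

theorem theorem7p3 (n m : ℕ) (u : Matrix.unitaryGroup (Fin n × Fin m) ℂ) :
    (∃ W : ((URA.column u).fock.tensor (URA.fockRep n)).Cpl ≃ₗᵢ[ℂ] URA.Fock₂ n m,
      (∀ (i : Fin n) (h : URA.Fock n) (ξ : (URA.column u).fock.Cpl),
        URA.shiftE m i (W (URA.PreCorr.tmulRight (URA.column u).fock (URA.fockRep n) h ξ)) =
          W (URA.PreCorr.tmulRight (URA.column u).fock (URA.fockRep n) h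
            ((URA.column u).fock.leftAction (URA.gen i) ξ))) ∧
      (∀ (j : Fin m) (h : URA.Fock n) (ξ : (URA.column u).fock.Cpl),
        URA.shiftF u j (W (URA.PreCorr.tmulRight (URA.column u).fock (URA.fockRep n) h ξ)) =
          W (URA.PreCorr.tmulRight (URA.column u).fock (URA.fockRep n) h
            ((URA.column u).creation (URA.colUnit u j) ξ))) ∧
      URA.Implements W (URA.analyticSub u) (URA.algA u) ∧
      URA.Implements W (URA.column u).tensorAlgebra (URA.algE u)) ∧
    URA.analyticSub u ≤ (URA.column u).tensorAlgebra ∧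
    URA.algA u ≤ URA.algE u ∧
    (∃ W : ((URA.column (URA.swapU u)).fock.tensor (URA.fockRep m)).Cpl ≃ₗᵢ[ℂ] URA.Fock₂ n m,
      (∀ (j : Fin m) (h : URA.Fock m) (ξ : (URA.column (URA.swapU u)).fock.Cpl),
        URA.shiftF u j
            (W (URA.PreCorr.tmulRight (URA.column (URA.swapU u)).fock (URA.fockRep m) h ξ)) =
          W (URA.PreCorr.tmulRight (URA.column (URA.swapU u)).fock (URA.fockRep m) h
            ((URA.column (URA.swapU u)).fock.leftAction (URA.gen j) ξ))) ∧
      (∀ (i : Fin n) (h : URA.Fock m) (ξ : (URA.column (URA.swapU u)).fock.Cpl),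
        URA.shiftE m i
            (W (URA.PreCorr.tmulRight (URA.column (URA.swapU u)).fock (URA.fockRep m) h ξ)) =
          W (URA.PreCorr.tmulRight (URA.column (URA.swapU u)).fock (URA.fockRep m) h
            ((URA.column (URA.swapU u)).creation (URA.colUnit (URA.swapU u) i) ξ))) ∧
      URA.Implements W (URA.column (URA.swapU u)).tensorAlgebra (URA.algF u)) ∧
    URA.algA u ≤ URA.algF u := by
  refine ⟨⟨(URA.modelE u).unitary, fun i h ξ => ((URA.modelE u).embed_leftAction_gen h i ξ).symm,
    fun j h ξ => ((URA.modelE u).embed_creation_colUnit h j ξ).symm,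
    (URA.modelE u).implements_analyticSub, (URA.modelE u).implements_tensorAlgebra⟩,
    URA.analyticSub_le u, ?_, ⟨(URA.modelF u).unitary,
    fun j h ξ => ((URA.modelF u).embed_leftAction_gen h j ξ).symm,
    fun i h ξ => ((URA.modelF u).embed_creation_colUnit h i ξ).symm, ?_⟩, ?_⟩
  · exact Subalgebra.topologicalClosure_mono (Algebra.adjoin_mono
      (Set.union_subset_union_left _ Set.subset_union_left))
  -- In the second model the adjoints that appear are those of its operators `E`, which are the
  -- shifts `L_{f_j}`.
  · rw [← URA.algStar_modelF]
    exact (URA.modelF u).implements_tensorAlgebra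
  · exact Subalgebra.topologicalClosure_mono (Algebra.adjoin_mono
      (Set.union_subset_union_left _ Set.subset_union_left))
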